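/- Let $\mathcal H$ be a finite-dimensional complex Hilbert space. For positive definite operators $\varrho,\sigma$ on $\mathcal H$ and $\alpha\in(0,\infty)$ put $$Q_\alpha(\varrho\|\sigma)=\operatorname{Tr}\varrho^{\alpha}\sigma^{1-\alpha},\qquad Q^*_\alpha(\varrho\|\sigma)=\operatorname{Tr}\bigl(\varrho^{1/2}\sigma^{\frac{1-\alpha}{\alpha}}\varrho^{1/2}\bigr)^{\alpha},\qquad Q^\flat_\alpha(\varrho\|\sigma)=\operatorname{Tr}e^{\alpha\log\varrho+(1-\alpha)\log\sigma}.$$ Let $(t)$ be one of the three superscripts (none, $*$, $\flat$). For non-zero positive semidefinite $\varrho,\sigma$ and $\alpha\in(0,\infty)\setminus\{1\}$ put $$Q^{(t)}_\alpha(\varrho\|\sigma)=\lim_{\varepsilon\searrow0}Q^{(t)}_\alpha(\varrho+\varepsilon I\|\sigma+\varepsilon I)\in[0,\infty],\qquad D^{(t)}_\alpha(\varrho\|\sigma)=\frac{1}{\alpha-1}\log Q^{(t)}_\alpha(\varrho\|\sigma)-\frac{1}{\alpha-1}\log\operatorname{Tr}\varrho ,$$ with $\log$ the natural logarithm, $\log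 0=-\infty$, $\log\infty=\infty$, and put $D^{(t)}_0=\lim_{\alpha\searrow0}D^{(t)}_\alpha$ and $D^{(t)}_\infty=\lim_{\alpha\to\infty}D^{(t)}_\alpha$ (limits in $[-\infty,\infty]$). Proposition. For all non-zero positive semidefinite operators $\varrho,\sigma$ on $\mathcal H$, all these limits exist, and $$D^*_\alpha(\varrho\|\sigma)\le D_\alpha(\varrho\|\sigma)\le D^\flat_\alpha(\varrho\|\sigma)\quad\text{for every }\alpha\in[0,1),$$ $$D^\flat_\alpha(\varrho\|\sigma)\le D^*_\alpha(\varrho\|\sigma)\le D_\alpha(\varrho\|\sigma)\quad\text{for every }\alpha\in(1,\infty].$$ -/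

import Mathlib

open Filter Topology
open scoped ENNReal

noncomputable section

/-- The three families of quantum Rényi divergences: `petz` is `D_α` (no superscript),
`sandwiched` is `D*_α`, and `logEuclidean` is `D♭_α`. -/
inductive RenyiFamily
  | petz
  | sandwiched
  | logEuclidean

/-- The (real part of the) trace of an operator on a finite-dimensional Hilbert space. -/
def opTrace {H : Type*} [NormedAddCommGroup H] [InnerProductSpace ℂ H]
    (A : H →L[ℂ] H) : ℝ :=
  (LinearMap.trace ℂ H (A : H →ₗ[ℂ] H)).re

/-- The defining formulas of `Q_α`, `Q*_α`, `Q♭_α` for positive definite operators: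
`Tr ρ^α σ^(1-α)`, `Tr (ρ^(1/2) σ^((1-α)/α) ρ^(1/2))^α`, and
`Tr exp (α log ρ + (1-α) log σ)`.
It is only ever evaluated at positive definite operators and at `α > 0`. -/
def renyiQPosDef {H : Type*} [NormedAddCommGroup H] [InnerProductSpace ℂ H] [CompleteSpace H]
    (t : RenyiFamily) (α : ℝ) (ρ σ : H →L[ℂ] H) : ℝ :=
  match t with
  | .petz => opTrace (ρ ^ α * σ ^ (1 - α))
  | .sandwiched =>
      opTrace ((ρ ^ (1 / 2 : ℝ) * σ ^ ((1 - α) / α) * ρ ^ (1 / 2 : ℝ)) ^ α)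
  | .logEuclidean => opTrace (NormedSpace.exp (α • CFC.log ρ + (1 - α) • CFC.log σ))

/-- The regularised quantity `Q_α^(t)(ρ + ε I ‖ σ + ε I)`, as an element of `[0, ∞]`. -/
def renyiQReg {H : Type*} [NormedAddCommGroup H] [InnerProductSpace ℂ H] [CompleteSpace H]
    (t : RenyiFamily) (α : ℝ) (ρ σ : H →L[ℂ] H) (ε : ℝ) : ℝ≥0∞ :=
  ENNReal.ofReal (renyiQPosDef t α (ρ + ε • (1 : H →L[ℂ] H)) (σ + ε • (1 : H →L[ℂ] H)))

/-- `Q_α^(t)(ρ‖σ) = lim_{ε ↘ 0} Q_α^(t)(ρ + ε I ‖ σ + ε I) ∈ [0, ∞]` for positive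
semidefinite operators. -/
def renyiQ {H : Type*} [NormedAddCommGroup H] [InnerProductSpace ℂ H] [CompleteSpace H]
    (t : RenyiFamily) (α : ℝ) (ρ σ : H →L[ℂ] H) : ℝ≥0∞ :=
  limUnder (𝓝[>] (0 : ℝ)) (renyiQReg t α ρ σ)

/-- `D_α^(t)(ρ‖σ) = (1/(α-1)) log Q_α^(t)(ρ‖σ) - (1/(α-1)) log Tr ρ` for
`α ∈ (0, ∞)`, `α ≠ 1`, with `log 0 = -∞` and `log ∞ = ∞`. -/
def renyiDivReal {H : Type*} [NormedAddCommGroup H] [InnerProductSpace ℂ H] [CompleteSpace H]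
    (t : RenyiFamily) (α : ℝ) (ρ σ : H →L[ℂ] H) : EReal :=
  ((1 / (α - 1) : ℝ) : EReal) * ENNReal.log (renyiQ t α ρ σ)
    - ((1 / (α - 1) * Real.log (opTrace ρ) : ℝ) : EReal)

/-- The quantum Rényi divergence `D_α^(t)(ρ‖σ)` for `α ∈ [0, ∞]`; at `α = 0, 1, ∞` it is the
limit `α ↘ 0`, `α → 1`, `α → ∞`, respectively. -/
def renyiDiv {H : Type*} [NormedAddCommGroup H] [InnerProductSpace ℂ H] [CompleteSpace H]
    (t : RenyiFamily) (α : ℝ≥0∞) (ρ σ : H →L[ℂ] H) : EReal :=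
  open Classical in
  if α = 0 then limUnder (𝓝[>] (0 : ℝ)) (fun a : ℝ => renyiDivReal t a ρ σ)
  else if α = 1 then limUnder (𝓝[≠] (1 : ℝ)) (fun a : ℝ => renyiDivReal t a ρ σ)
  else if α = ⊤ then limUnder atTop (fun a : ℝ => renyiDivReal t a ρ σ)
  else renyiDivReal t α.toReal ρ σ

end

/-! For positive definite operators the claim is a comparison of traces: `Q♭ ≤ Q ≤ Q*` when `α < 1`
and `Q♭ ≤ Q* ≤ Q` when `α > 1`; the sign of `1/(α-1)` turns these into the two chains of
divergences. They are instances of the Araki–Lieb–Thirring inequality (`opTrace_rpow_conj_rpow_le`)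
and the Golden–Thompson inequality (`opTrace_exp_smul_log_add_log_le`).

Both inequalities follow from a weak majorization of log-spectra, tested on the functions `x ↦ (x -
c)₊`. For fixed `c`, raising the small eigenvalues of `Y = B^(1/2) A B^(1/2)` to `e^c` enlarges `A`
to some `A'`. Operator monotonicity of `t ↦ t^θ` or of `log` carries this enlargement to the other
side, and the trace of the resulting logarithm is computed exactly, because `Tr log = log det` is
additive even on products that do not commute.

For semidefinite operators the limit `ε ↘ 0` is shown to exist in `[0, ∞]` for each family
(`exists_tendsto_renyiQReg`), and inequalities pass to it. The limits `α ↘ 0` and `α → ∞` exist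
because each divergence increases with `α` (`secant_log_renyiQPosDef_mono`): it is a secant slope
based at `α = 1` of the convex function `log Q` for two families, and a variational argument
replaces this convexity for the sandwiched one. -/

set_option linter.unusedSectionVars false

/-! ### Functional calculus, trace and determinant in an eigenbasis. -/

section Eigenbasis

variable {H : Type*} [NormedAddCommGroup H] [InnerProductSpace ℂ H]
variable {ι : Type*} [Fintype ι]

/-- The real quadratic form `v ↦ re ⟪v, A v⟫` of an operator. -/
noncomputable def quadForm (A : H →L[ℂ] H) (v : H) : ℝ := (inner ℂ v (A v)).re

/-- The orthonormal basis `b` diagonalises `A`, with real eigenvalues `l`. -/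
def IsEigenbasis (A : H →L[ℂ] H) (b : OrthonormalBasis ι ℂ H) (l : ι → ℝ) : Prop :=
  ∀ i, A (b i) = l i • b i

theorem quadForm_add (A B : H →L[ℂ] H) (v : H) :
    quadForm (A + B) v = quadForm A v + quadForm B v := by
  simp [quadForm]

theorem quadForm_sub (A B : H →L[ℂ] H) (v : H) :
    quadForm (A - B) v = quadForm A v - quadForm B v := by
  simp [quadForm]

theorem quadForm_smul (c : ℝ) (A : H →L[ℂ] H) (v : H) :
    quadForm (c • A) v = c * quadForm A v := by
  simp [quadForm, ← Complex.coe_smul]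

theorem quadForm_one (v : H) : quadForm (1 : H →L[ℂ] H) v = ‖v‖ ^ 2 := by
  simp only [quadForm, one_apply_eq_self]
  exact inner_self_eq_norm_sq (𝕜 := ℂ) v

theorem quadForm_mono {A B : H →L[ℂ] H} (h : A ≤ B) (v : H) : quadForm A v ≤ quadForm B v := by
  have := ((ContinuousLinearMap.le_def _ _).1 h).re_inner_nonneg_right v
  have h2 := quadForm_sub B A v
  simp only [quadForm] at h2 ⊢
  have h3 : 0 ≤ (inner ℂ v ((B - A) v)).re := this
  linarith

theorem quadForm_nonneg {A : H →L[ℂ] H} (h : 0 ≤ A) (v : H) : 0 ≤ quadForm A v := by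
  simpa [quadForm] using quadForm_mono h v

theorem opTrace_eq_sum (A : H →L[ℂ] H) (b : OrthonormalBasis ι ℂ H) :
    opTrace A = ∑ i, quadForm A (b i) := by
  simp [opTrace, quadForm, LinearMap.trace_eq_sum_inner _ b]

theorem opTrace_mul_comm (A B : H →L[ℂ] H) : opTrace (A * B) = opTrace (B * A) := by
  unfold opTrace
  congr 1
  exact LinearMap.trace_mul_comm ℂ (A : H →ₗ[ℂ] H) (B : H →ₗ[ℂ] H)

theorem IsEigenbasis.quadForm {A : H →L[ℂ] H} {b : OrthonormalBasis ι ℂ H} {l : ι → ℝ}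
    (h : IsEigenbasis A b l) (i : ι) : quadForm A (b i) = l i := by
  simp [_root_.quadForm, h i, ← Complex.coe_smul]

theorem IsEigenbasis.opTrace {A : H →L[ℂ] H} {b : OrthonormalBasis ι ℂ H} {l : ι → ℝ}
    (h : IsEigenbasis A b l) : opTrace A = ∑ i, l i := by
  rw [opTrace_eq_sum A b]
  exact Finset.sum_congr rfl fun i _ => h.quadForm i

theorem IsEigenbasis.quadForm_eq {A : H →L[ℂ] H} {b : OrthonormalBasis ι ℂ H} {l : ι → ℝ}
    (h : IsEigenbasis A b l) (v : H) : _root_.quadForm A v = ∑ i, ‖inner ℂ (b i) v‖ ^ 2 * l i := by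
  have hv : A v = ∑ i, inner ℂ (b i) v • l i • b i := by
    conv_lhs => rw [← b.sum_repr' v]
    simp [h _]
  simp only [_root_.quadForm, hv, inner_sum, ← Complex.coe_smul, inner_smul_right,
    Complex.re_sum]
  refine Finset.sum_congr rfl fun i _ => ?_
  have h1 : inner ℂ (b i) v * inner ℂ v (b i) = ((‖inner ℂ (b i) v‖ ^ 2 : ℝ) : ℂ) := by
    rw [← inner_conj_symm v (b i), Complex.mul_conj, Complex.normSq_eq_norm_sq]
  rw [mul_left_comm, h1, ← Complex.ofReal_mul, Complex.ofReal_re, mul_comm]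

/-- Reduces identities between functions of one operator to scalar identities between eigenvalues.
-/
theorem IsEigenbasis.unique {A B : H →L[ℂ] H} {b : OrthonormalBasis ι ℂ H} {l : ι → ℝ}
    (hA : IsEigenbasis A b l) (hB : IsEigenbasis B b l) : A = B := by
  apply ContinuousLinearMap.coe_injective
  refine b.toBasis.ext fun i => ?_
  simp [hA i, hB i]

theorem IsEigenbasis.congr {A : H →L[ℂ] H} {b : OrthonormalBasis ι ℂ H} {l l' : ι → ℝ}
    (hA : IsEigenbasis A b l) (h : ∀ i, l i = l' i) : IsEigenbasis A b l' :=
  fun i => by rw [hA i, h i]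

theorem IsEigenbasis.add {A B : H →L[ℂ] H} {b : OrthonormalBasis ι ℂ H} {l m : ι → ℝ}
    (hA : IsEigenbasis A b l) (hB : IsEigenbasis B b m) :
    IsEigenbasis (A + B) b (fun i => l i + m i) := fun i => by
  simp [hA i, hB i, add_smul]

theorem IsEigenbasis.smul {A : H →L[ℂ] H} {b : OrthonormalBasis ι ℂ H} {l : ι → ℝ}
    (hA : IsEigenbasis A b l) (c : ℝ) :
    IsEigenbasis (c • A) b (fun i => c * l i) := fun i => by
  simp [hA i, mul_smul]

theorem isEigenbasis_one (b : OrthonormalBasis ι ℂ H) :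
    IsEigenbasis (1 : H →L[ℂ] H) b (fun _ => 1) := fun i => by simp

theorem IsEigenbasis.det {A : H →L[ℂ] H} {b : OrthonormalBasis ι ℂ H} {l : ι → ℝ}
    (h : IsEigenbasis A b l) : LinearMap.det (A : H →ₗ[ℂ] H) = ((∏ i, l i : ℝ) : ℂ) := by
  classical
  rw [← LinearMap.det_toMatrix b.toBasis]
  have : LinearMap.toMatrix b.toBasis b.toBasis (A : H →ₗ[ℂ] H)
      = Matrix.diagonal (fun i => (l i : ℂ)) := by
    ext i j
    simp [LinearMap.toMatrix_apply, h j, Matrix.diagonal_apply, ← Complex.coe_smul]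
    split_ifs with hij <;> simp [*]
  rw [this, Matrix.det_diagonal]
  push_cast
  rfl

variable [FiniteDimensional ℂ H] [CompleteSpace H]

theorem exists_isEigenbasis {A : H →L[ℂ] H} (hA : IsSelfAdjoint A) :
    ∃ (b : OrthonormalBasis (Fin (Module.finrank ℂ H)) ℂ H)
      (l : Fin (Module.finrank ℂ H) → ℝ), IsEigenbasis A b l := by
  have hs := ContinuousLinearMap.isSelfAdjoint_iff_isSymmetric.1 hA
  refine ⟨hs.eigenvectorBasis rfl, hs.eigenvalues rfl, fun i => ?_⟩
  have := hs.apply_eigenvectorBasis rfl i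
  rw [← Complex.coe_smul]
  exact this

theorem finite_real_spectrum (A : H →L[ℂ] H) : (spectrum ℝ A).Finite := by
  have h1 : (spectrum ℂ A).Finite := by
    have := AlgEquiv.spectrum_eq (Module.End.toContinuousLinearMap H) (A : H →ₗ[ℂ] H)
    have h2 := Module.End.finite_spectrum (A : H →ₗ[ℂ] H)
    rw [← this] at h2
    exact h2
  have h3 : spectrum ℝ A = (algebraMap ℝ ℂ) ⁻¹' (spectrum ℂ A) := (spectrum.preimage_algebraMap ℂ).symm
  rw [h3]
  exact h1.preimage (algebraMap ℝ ℂ).injective.injOn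

theorem cfc_apply_of_apply_eq_smul {A : H →L[ℂ] H} (hA : IsSelfAdjoint A) (f : ℝ → ℝ) {v : H}
    {l : ℝ} (hv : A v = l • v) : cfc f A v = f l • v := by
  classical
  -- On a finite spectrum any `f` agrees with an interpolating polynomial. The node `l` is added
  -- because it need not lie in the spectrum when `v = 0`.
  set s : Finset ℝ := insert l (finite_real_spectrum A).toFinset with hs
  set q : Polynomial ℝ := Lagrange.interpolate s id f with hq
  have hev : ∀ x ∈ s, q.eval x = f x := fun x hx =>
    Lagrange.eval_interpolate_at_node f (Function.injective_id.injOn) hx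
  have h1 : cfc f A = cfc q.eval A := cfc_congr fun x hx => (hev x (by simp [hs, hx])).symm
  rw [h1, cfc_polynomial q A hA, ← hev l (by simp [hs])]
  have hpow : ∀ n : ℕ, (A ^ n) v = l ^ n • v := fun n => by
    induction n with
    | zero => simp
    | succ n ih =>
      rw [pow_succ', mul_apply_eq_comp, ih, ContinuousLinearMap.map_smul_of_tower, hv, smul_smul,
        pow_succ]
  clear_value q
  clear h1 hev hq
  induction q using Polynomial.induction_on' with
  | add p r hp hr => simp [hp, hr, add_smul]
  | monomial n a => simp [Polynomial.aeval_monomial, Algebra.algebraMap_eq_smul_one, hpow, mul_smul]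

theorem IsEigenbasis.cfc {A : H →L[ℂ] H} {b : OrthonormalBasis ι ℂ H} {l : ι → ℝ}
    (h : IsEigenbasis A b l) (hA : IsSelfAdjoint A) (f : ℝ → ℝ) :
    IsEigenbasis (cfc f A) b (fun i => f (l i)) :=
  fun i => cfc_apply_of_apply_eq_smul hA f (h i)

theorem IsEigenbasis.rpow {A : H →L[ℂ] H} {b : OrthonormalBasis ι ℂ H} {l : ι → ℝ}
    (h : IsEigenbasis A b l) (hA : 0 ≤ A) (r : ℝ) :
    IsEigenbasis (A ^ r) b (fun i => l i ^ r) := by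
  rw [CFC.rpow_eq_cfc_real hA]
  exact h.cfc hA.isSelfAdjoint _

theorem IsEigenbasis.log {A : H →L[ℂ] H} {b : OrthonormalBasis ι ℂ H} {l : ι → ℝ}
    (h : IsEigenbasis A b l) (hA : IsSelfAdjoint A) :
    IsEigenbasis (CFC.log A) b (fun i => Real.log (l i)) :=
  h.cfc hA _

theorem IsEigenbasis.exp {A : H →L[ℂ] H} {b : OrthonormalBasis ι ℂ H} {l : ι → ℝ}
    (h : IsEigenbasis A b l) (hA : IsSelfAdjoint A) :
    IsEigenbasis (NormedSpace.exp A) b (fun i => Real.exp (l i)) := by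
  rw [← CFC.real_exp_eq_normedSpace_exp hA]
  exact h.cfc hA _

theorem IsEigenbasis.nonneg {A : H →L[ℂ] H} {b : OrthonormalBasis ι ℂ H} {l : ι → ℝ}
    (h : IsEigenbasis A b l) (hA : 0 ≤ A) (i : ι) : 0 ≤ l i :=
  h.quadForm i ▸ quadForm_nonneg hA (b i)

theorem IsEigenbasis.pos {A : H →L[ℂ] H} {b : OrthonormalBasis ι ℂ H} {l : ι → ℝ}
    (h : IsEigenbasis A b l) (hA : IsStrictlyPositive A) (i : ι) : 0 < l i := by
  refine lt_of_le_of_ne (h.nonneg hA.nonneg i) fun h0 => ?_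
  obtain ⟨u, hu⟩ := hA.isUnit
  have h1 : A (b i) = 0 := by rw [h i, ← h0, zero_smul]
  have h2 : b i = (↑u⁻¹ * A) (b i) := by rw [← hu]; simp
  rw [mul_apply_eq_comp, h1, map_zero] at h2
  exact b.orthonormal.ne_zero i h2

theorem isStrictlyPositive_exp {A : H →L[ℂ] H} (hA : IsSelfAdjoint A) :
    IsStrictlyPositive (NormedSpace.exp A) := by
  let := NormedAlgebra.restrictScalars ℚ ℂ (H →L[ℂ] H)
  exact (NormedSpace.isUnit_exp _).isStrictlyPositive hA.exp_nonneg

theorem IsEigenbasis.isStrictlyPositive {A : H →L[ℂ] H} {b : OrthonormalBasis ι ℂ H} {l : ι → ℝ}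
    (h : IsEigenbasis A b l) (hA : IsSelfAdjoint A) (hl : ∀ i, 0 < l i) :
    IsStrictlyPositive A := by
  have : A = NormedSpace.exp (CFC.log A) := by
    refine h.unique ((((h.log hA).exp IsSelfAdjoint.log)).congr fun i => Real.exp_log (hl i))
  rw [this]
  exact isStrictlyPositive_exp IsSelfAdjoint.log

theorem IsStrictlyPositive.conj {A B : H →L[ℂ] H} (hA : IsStrictlyPositive A)
    (hB : IsStrictlyPositive B) : IsStrictlyPositive (B * A * B) :=
  ((hB.isUnit.mul hA.isUnit).mul hB.isUnit).isStrictlyPositive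
    (conjugate_nonneg_of_nonneg hA.nonneg hB.nonneg)

theorem det_eq_exp_trace_log {A : H →L[ℂ] H} (hA : IsStrictlyPositive A) :
    LinearMap.det (A : H →ₗ[ℂ] H) = ((Real.exp (opTrace (CFC.log A)) : ℝ) : ℂ) := by
  obtain ⟨b, l, h⟩ := exists_isEigenbasis hA.isSelfAdjoint
  rw [h.det, (h.log hA.isSelfAdjoint).opTrace, Real.exp_sum]
  congr 2 with i
  rw [Real.exp_log (h.pos hA i)]

/-- The determinant is multiplicative, so `Tr log = log det` is additive although `log` itself is
not on noncommuting factors. -/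
theorem opTrace_log_conj {A B : H →L[ℂ] H} (hA : IsStrictlyPositive A)
    (hB : IsStrictlyPositive B) :
    opTrace (CFC.log (B * A * B)) = opTrace (CFC.log A) + 2 * opTrace (CFC.log B) := by
  have h := det_eq_exp_trace_log (hA.conj hB)
  have h1 : ((B * A * B : H →L[ℂ] H) : H →ₗ[ℂ] H)
      = (B : H →ₗ[ℂ] H) * (A : H →ₗ[ℂ] H) * (B : H →ₗ[ℂ] H) := rfl
  rw [h1, map_mul, map_mul, det_eq_exp_trace_log hA, det_eq_exp_trace_log hB] at h
  have h2 : Real.exp (opTrace (CFC.log B)) * Real.exp (opTrace (CFC.log A)) *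
      Real.exp (opTrace (CFC.log B)) = Real.exp (opTrace (CFC.log (B * A * B))) := by
    exact_mod_cast h
  rw [← Real.exp_add, ← Real.exp_add] at h2
  linarith [Real.exp_injective h2]

theorem log_rpow' {A : H →L[ℂ] H} (hA : IsStrictlyPositive A) (r : ℝ) :
    CFC.log (A ^ r) = r • CFC.log A := by
  obtain ⟨b, l, h⟩ := exists_isEigenbasis hA.isSelfAdjoint
  refine (((h.rpow hA.nonneg r).log CFC.rpow_nonneg.isSelfAdjoint).congr fun i => ?_).unique
    ((h.log hA.isSelfAdjoint).smul r)
  exact Real.log_rpow (h.pos hA i) r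

theorem opTrace_smul (c : ℝ) (A : H →L[ℂ] H) : opTrace (c • A) = c * opTrace A := by
  simp [opTrace_eq_sum _ (stdOrthonormalBasis ℂ H), quadForm_smul, Finset.mul_sum]

theorem opTrace_add (A B : H →L[ℂ] H) : opTrace (A + B) = opTrace A + opTrace B := by
  simp [opTrace_eq_sum _ (stdOrthonormalBasis ℂ H), quadForm_add, Finset.sum_add_distrib]

end Eigenbasis

/-! ### Weak log-majorization, Araki–Lieb–Thirring and Golden–Thompson. -/

section Majorization

variable {ι : Type*} [Fintype ι]

/-- Taylor's formula at `a` with integral remainder; the positive part lets the range of integration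
reach a `b` independent of `t`. For `q ≥ 0` this exhibits `exp (q t)` as a constant plus a
nonnegative mixture of functions `(t - c)₊`. -/
theorem exp_eq_integral_posPart {q a b t : ℝ} (hat : a ≤ t) (htb : t ≤ b) :
    Real.exp (q * t) = Real.exp (q * a) + q * Real.exp (q * a) * (t - a)
      + ∫ c in a..b, q ^ 2 * Real.exp (q * c) * max (t - c) 0 := by
  have hint : ∀ u v : ℝ, IntervalIntegrable
      (fun c => q ^ 2 * Real.exp (q * c) * max (t - c) 0) MeasureTheory.volume u v := fun u v =>
    Continuous.intervalIntegrable (by fun_prop) u v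
  rw [← intervalIntegral.integral_add_adjacent_intervals (hint a t) (hint t b)]
  have h2 : ∫ c in t..b, q ^ 2 * Real.exp (q * c) * max (t - c) 0 = 0 := by
    rw [intervalIntegral.integral_congr (g := fun _ => (0 : ℝ))]
    · simp
    · intro c hc
      rw [Set.uIcc_of_le htb] at hc
      simp [hc.1]
  have h1 : ∫ c in a..t, q ^ 2 * Real.exp (q * c) * max (t - c) 0
      = (q * (t - t) * Real.exp (q * t) + Real.exp (q * t))
        - (q * (t - a) * Real.exp (q * a) + Real.exp (q * a)) := by
    rw [intervalIntegral.integral_congr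
      (g := fun c => q ^ 2 * Real.exp (q * c) * (t - c))]
    · refine intervalIntegral.integral_eq_sub_of_hasDerivAt
        (f := fun c => q * (t - c) * Real.exp (q * c) + Real.exp (q * c)) (fun c _ => ?_)
        (Continuous.intervalIntegrable (by fun_prop) _ _)
      have he : HasDerivAt (fun c => Real.exp (q * c)) (Real.exp (q * c) * (q * 1)) c :=
        ((hasDerivAt_id c).const_mul q).exp
      have hl : HasDerivAt (fun c => q * (t - c)) (q * (-1)) c :=
        ((hasDerivAt_id c).const_sub t).const_mul q
      convert! (hl.mul he).add he using 1
      ring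
    · intro c hc
      rw [Set.uIcc_of_le hat] at hc
      simp [hc.2]
  rw [h1, h2]
  ring

/-- Weak submajorization, expressed through the functions `x ↦ (x - c)₊`, passes to
exponential sums. -/
theorem sum_exp_le_sum_exp_of_sum_posPart_le {x y : ι → ℝ}
    (h : ∀ c : ℝ, ∑ i, max (x i - c) 0 ≤ ∑ i, max (y i - c) 0) {q : ℝ} (hq : 0 ≤ q) :
    ∑ i, Real.exp (q * x i) ≤ ∑ i, Real.exp (q * y i) := by
  obtain ⟨a, ha⟩ : ∃ a : ℝ, ∀ i, a ≤ x i ∧ a ≤ y i := by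
    obtain ⟨a, ha⟩ := (Set.finite_range (fun i => min (x i) (y i))).bddBelow
    exact ⟨a, fun i => le_min_iff.1 (ha ⟨i, rfl⟩)⟩
  obtain ⟨b, hb⟩ : ∃ b : ℝ, ∀ i, x i ≤ b ∧ y i ≤ b := by
    obtain ⟨b, hb⟩ := (Set.finite_range (fun i => max (x i) (y i))).bddAbove
    exact ⟨b, fun i => max_le_iff.1 (hb ⟨i, rfl⟩)⟩
  rcases isEmpty_or_nonempty ι with he | ⟨⟨i0⟩⟩
  · simp
  have hab : a ≤ b := (ha i0).1.trans (hb i0).1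
  have key : ∀ z : ι → ℝ, (∀ i, a ≤ z i) → (∀ i, z i ≤ b) →
      ∑ i, Real.exp (q * z i) = (∑ _i : ι, Real.exp (q * a))
        + q * Real.exp (q * a) * ∑ i, max (z i - a) 0
        + ∫ c in a..b, q ^ 2 * Real.exp (q * c) * ∑ i, max (z i - c) 0 := by
    intro z hza hzb
    simp only [Finset.mul_sum]
    rw [intervalIntegral.integral_finsetSum fun i _ =>
      Continuous.intervalIntegrable (by fun_prop) _ _, ← Finset.sum_add_distrib,
      ← Finset.sum_add_distrib]
    refine Finset.sum_congr rfl fun i _ => ?_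
    rw [max_eq_left (sub_nonneg.2 (hza i))]
    exact exp_eq_integral_posPart (hza i) (hzb i)
  rw [key x (fun i => (ha i).1) (fun i => (hb i).1), key y (fun i => (ha i).2) fun i => (hb i).2]
  have h1 := h a
  gcongr
  refine intervalIntegral.integral_mono_on hab (Continuous.intervalIntegrable (by fun_prop) _ _)
    (Continuous.intervalIntegrable (by fun_prop) _ _) fun c _ => ?_
  have h2 := h c
  gcongr

variable {H : Type*} [NormedAddCommGroup H] [InnerProductSpace ℂ H]

/-- In the eigenbasis of `K`, each diagonal entry of `L` dominates both `x i` and `c`. -/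
theorem sum_posPart_le_opTrace {K L : H →L[ℂ] H} {c : ℝ} {b : OrthonormalBasis ι ℂ H} {x : ι → ℝ}
    (hK : IsEigenbasis K b x) (hKL : K ≤ L) (hL : c • (1 : H →L[ℂ] H) ≤ L) :
    ∑ i, max (x i - c) 0 ≤ opTrace L - ∑ _i : ι, c := by
  rw [opTrace_eq_sum L b, ← Finset.sum_sub_distrib]
  refine Finset.sum_le_sum fun i _ => max_le ?_ ?_
  · have := quadForm_mono hKL (b i)
    rw [hK.quadForm i] at this
    linarith
  · have := quadForm_mono hL (b i)
    rw [quadForm_smul, quadForm_one, b.norm_eq_one] at this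
    linarith

variable [FiniteDimensional ℂ H] [CompleteSpace H]

local notation "𝟙" => (1 : H →L[ℂ] H)

theorem IsEigenbasis.opTrace_log_truncation {Y : H →L[ℂ] H} {b : OrthonormalBasis ι ℂ H} {y : ι → ℝ}
    (hY : IsEigenbasis Y b y) (hYpos : IsStrictlyPositive Y) (c : ℝ) :
    _root_.opTrace (CFC.log (_root_.cfc (fun t => max t (Real.exp c)) Y)) - ∑ _i : ι, c
      = ∑ i, max (Real.log (y i) - c) 0 := by
  rw [((hY.cfc hYpos.isSelfAdjoint _).log (cfc_predicate _ _)).opTrace, ← Finset.sum_sub_distrib]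
  refine Finset.sum_congr rfl fun i _ => ?_
  have hy := hY.pos hYpos i
  rw [← sub_self c, max_sub_sub_right]
  congr 1
  rcases le_total (y i) (Real.exp c) with h | h
  · rw [max_eq_right h, Real.log_exp, max_eq_right]
    rwa [Real.log_le_iff_le_exp hy]
  · rw [max_eq_left h, max_eq_left]
    rwa [Real.le_log_iff_exp_le hy]

theorem le_truncation {Y : H →L[ℂ] H} (hY : IsSelfAdjoint Y) (c : ℝ) :
    Y ≤ cfc (fun t => max t c) Y := by
  conv_lhs => rw [← cfc_id' ℝ Y hY]
  exact cfc_mono fun x _ => le_max_left _ _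

theorem smul_one_le_truncation {Y : H →L[ℂ] H} (hY : IsSelfAdjoint Y) (c : ℝ) :
    c • 𝟙 ≤ cfc (fun t => max t c) Y := by
  have : c • 𝟙 = cfc (fun _ : ℝ => c) Y := by
    rw [cfc_const c Y hY, Algebra.algebraMap_eq_smul_one]
  rw [this]
  exact cfc_mono fun x _ => le_max_right _ _

theorem conj_rpow_neg_conj_rpow {A B : H →L[ℂ] H} (hB : IsStrictlyPositive B) (r : ℝ) :
    B ^ (-r) * (B ^ r * A * B ^ r) * B ^ (-r) = A := by
  calc B ^ (-r) * (B ^ r * A * B ^ r) * B ^ (-r)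
      = (B ^ (-r) * B ^ r) * A * (B ^ r * B ^ (-r)) := by noncomm_ring
    _ = A := by rw [CFC.rpow_neg_mul_rpow r hB, CFC.rpow_mul_rpow_neg r hB, one_mul, mul_one]

theorem rpow_rpow_of_isStrictlyPositive {A : H →L[ℂ] H} (hA : IsStrictlyPositive A) (r s : ℝ) :
    (A ^ r) ^ s = A ^ (r * s) := by
  obtain ⟨b, l, h⟩ := exists_isEigenbasis hA.isSelfAdjoint
  exact (((h.rpow hA.nonneg r).rpow CFC.rpow_nonneg s).congr fun i =>
    (Real.rpow_mul (h.nonneg hA.nonneg i) r s).symm).unique (h.rpow hA.nonneg (r * s))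

theorem isStrictlyPositive_truncation {Y : H →L[ℂ] H} (hY : IsStrictlyPositive Y) (c : ℝ) :
    IsStrictlyPositive (cfc (fun t => max t c) Y) :=
  hY.of_le (le_truncation hY.isSelfAdjoint c)

theorem smul_one_le_log {N : H →L[ℂ] H} {c : ℝ} (h : Real.exp c • 𝟙 ≤ N) : c • 𝟙 ≤ CFC.log N := by
  have hb := isEigenbasis_one (stdOrthonormalBasis ℂ H)
  have hsa : IsSelfAdjoint (Real.exp c • 𝟙) := (IsSelfAdjoint.all _).smul (IsSelfAdjoint.one _)
  have h1 : CFC.log (Real.exp c • 𝟙) = c • 𝟙 :=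
    (((hb.smul _).log hsa).congr fun i => by simp).unique (hb.smul c)
  rw [← h1]
  exact CFC.log_le_log h ((hb.smul _).isStrictlyPositive hsa fun i => by simpa using Real.exp_pos c)

/-- The Araki–Lieb–Thirring inequality as a weak log-majorization. -/
theorem sum_posPart_log_conj_rpow_le {A B : H →L[ℂ] H} (hA : IsStrictlyPositive A)
    (hB : IsStrictlyPositive B) {θ : ℝ} (hθ0 : 0 < θ) (hθ1 : θ ≤ 1)
    {b : OrthonormalBasis ι ℂ H} {x : ι → ℝ} {b' : OrthonormalBasis ι ℂ H} {y : ι → ℝ}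
    (hx : IsEigenbasis (B ^ (θ / 2) * A ^ θ * B ^ (θ / 2)) b x)
    (hy : IsEigenbasis (B ^ (1 / 2 : ℝ) * A * B ^ (1 / 2 : ℝ)) b' y) (c : ℝ) :
    ∑ i, max (Real.log (x i) - c) 0 ≤ ∑ i, max (θ * Real.log (y i) - c) 0 := by
  -- With the threshold written `θ * c`, the matching truncation level for `Y` is `exp c`.
  obtain ⟨c, rfl⟩ : ∃ c', c = θ * c' := ⟨c / θ, by field_simp⟩
  set Y := B ^ (1 / 2 : ℝ) * A * B ^ (1 / 2 : ℝ) with hYdef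
  have hBr : ∀ r : ℝ, IsStrictlyPositive (B ^ r) := fun r => hB.rpow B r
  have hYpos : IsStrictlyPositive Y := hA.conj (hBr _)
  set Y' := cfc (fun t => max t (Real.exp c)) Y with hY'
  have hY'pos : IsStrictlyPositive Y' := isStrictlyPositive_truncation hYpos _
  -- Undoing the conjugation turns `Y' ≥ Y` and `Y' ≥ e^c` into `A' ≥ A` and `A' ≥ e^c B⁻¹`.
  set A' := B ^ (-(1 / 2) : ℝ) * Y' * B ^ (-(1 / 2) : ℝ) with hA'
  have hA'pos : IsStrictlyPositive A' := hY'pos.conj (hBr _)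
  have hAA' : A ≤ A' := by
    have := conjugate_le_conjugate_of_nonneg (le_truncation hYpos.isSelfAdjoint (Real.exp c))
      (hBr (-(1 / 2))).nonneg
    rwa [hYdef, conj_rpow_neg_conj_rpow hB] at this
  have hBA' : Real.exp c • B ^ (-1 : ℝ) ≤ A' := by
    have := conjugate_le_conjugate_of_nonneg (smul_one_le_truncation hYpos.isSelfAdjoint
      (Real.exp c)) (hBr (-(1 / 2))).nonneg
    rw [mul_smul_comm, mul_one, smul_mul_assoc, ← CFC.rpow_add hB.isUnit] at this
    convert! this using 3
    norm_num
  set N := B ^ (θ / 2) * A' ^ θ * B ^ (θ / 2) with hN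
  -- Löwner–Heinz: `t ↦ t ^ θ` is operator monotone for `θ ∈ [0, 1]`. The same fact applied to `A' ≥
  -- e^c B⁻¹` gives the lower bound `hNc`.
  have hMN : B ^ (θ / 2) * A ^ θ * B ^ (θ / 2) ≤ N :=
    conjugate_le_conjugate_of_nonneg (CFC.rpow_le_rpow ⟨hθ0.le, hθ1⟩ hAA') (hBr _).nonneg
  have hNc : Real.exp (θ * c) • 𝟙 ≤ N := by
    have h1 := CFC.rpow_le_rpow (p := θ) ⟨hθ0.le, hθ1⟩ hBA'
    have h2 : (Real.exp c • B ^ (-1 : ℝ)) ^ θ = Real.exp (θ * c) • B ^ (-θ) := by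
      obtain ⟨b, l, h⟩ := exists_isEigenbasis hB.isSelfAdjoint
      refine ((((h.rpow hB.nonneg _).smul _).rpow
        (smul_nonneg (Real.exp_pos c).le CFC.rpow_nonneg) θ).congr fun i => ?_).unique
        ((h.rpow hB.nonneg _).smul _)
      have := h.pos hB i
      rw [Real.mul_rpow (by positivity) (by positivity), ← Real.exp_mul, mul_comm c,
        ← Real.rpow_mul this.le]
      norm_num
    rw [h2] at h1
    have h3 := conjugate_le_conjugate_of_nonneg h1 (hBr (θ / 2)).nonneg
    rw [mul_smul_comm, smul_mul_assoc, ← CFC.rpow_add hB.isUnit, ← CFC.rpow_add hB.isUnit] at h3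
    convert! h3 using 2
    rw [show θ / 2 + -θ + θ / 2 = 0 by ring, CFC.rpow_zero B hB.nonneg]
  have hMpos : IsStrictlyPositive (B ^ (θ / 2) * A ^ θ * B ^ (θ / 2)) :=
    (hA.rpow A θ).conj (hBr _)
  refine (sum_posPart_le_opTrace (hx.log hMpos.isSelfAdjoint) (CFC.log_le_log hMN hMpos)
    (smul_one_le_log hNc)).trans (le_of_eq ?_)
  -- The contributions of `B` cancel, leaving `Tr log N = θ Tr log Y'`.
  rw [hN, opTrace_log_conj (hA'pos.rpow _ _) (hBr _), log_rpow' hA'pos, log_rpow' hB, opTrace_smul,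
    opTrace_smul, hA', opTrace_log_conj hY'pos (hBr _), log_rpow' hB, opTrace_smul]
  have h4 := hy.opTrace_log_truncation hYpos c
  simp only [← mul_sub]
  simp only [← Finset.mul_sum]
  have h5 : ∑ i, max (θ * (Real.log (y i) - c)) 0 = θ * ∑ i, max (Real.log (y i) - c) 0 := by
    rw [Finset.mul_sum]
    refine Finset.sum_congr rfl fun i _ => ?_
    rw [mul_max_of_nonneg _ _ hθ0.le, mul_zero]
  rw [h5, ← h4]
  ring

/-- The Golden–Thompson inequality as a weak log-majorization. -/
theorem sum_posPart_add_le {A B : H →L[ℂ] H} (hA : IsStrictlyPositive A)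
    (hB : IsStrictlyPositive B)
    {b : OrthonormalBasis ι ℂ H} {x : ι → ℝ} {b' : OrthonormalBasis ι ℂ H} {y : ι → ℝ}
    (hx : IsEigenbasis (CFC.log A + CFC.log B) b x)
    (hy : IsEigenbasis (B ^ (1 / 2 : ℝ) * A * B ^ (1 / 2 : ℝ)) b' y) (c : ℝ) :
    ∑ i, max (x i - c) 0 ≤ ∑ i, max (Real.log (y i) - c) 0 := by
  set Y := B ^ (1 / 2 : ℝ) * A * B ^ (1 / 2 : ℝ) with hYdef
  have hBr : ∀ r : ℝ, IsStrictlyPositive (B ^ r) := fun r => hB.rpow B r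
  have hYpos : IsStrictlyPositive Y := hA.conj (hBr _)
  set Y' := cfc (fun t => max t (Real.exp c)) Y with hY'
  have hY'pos : IsStrictlyPositive Y' := isStrictlyPositive_truncation hYpos _
  set A' := B ^ (-(1 / 2) : ℝ) * Y' * B ^ (-(1 / 2) : ℝ) with hA'
  have hA'pos : IsStrictlyPositive A' := hY'pos.conj (hBr _)
  have hAA' : A ≤ A' := by
    have := conjugate_le_conjugate_of_nonneg (le_truncation hYpos.isSelfAdjoint (Real.exp c))
      (hBr (-(1 / 2))).nonneg
    rwa [hYdef, conj_rpow_neg_conj_rpow hB] at this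
  have hBA' : Real.exp c • B ^ (-1 : ℝ) ≤ A' := by
    have := conjugate_le_conjugate_of_nonneg (smul_one_le_truncation hYpos.isSelfAdjoint
      (Real.exp c)) (hBr (-(1 / 2))).nonneg
    rw [mul_smul_comm, mul_one, smul_mul_assoc, ← CFC.rpow_add hB.isUnit] at this
    convert! this using 3
    norm_num
  -- Operator monotonicity of `log` plays the role of Löwner–Heinz here.
  have hlog : c • 𝟙 + (-1 : ℝ) • CFC.log B ≤ CFC.log A' := by
    have hnn : 0 ≤ Real.exp c • B ^ (-1 : ℝ) := smul_nonneg (Real.exp_pos c).le CFC.rpow_nonneg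
    obtain ⟨b, l, h⟩ := exists_isEigenbasis hB.isSelfAdjoint
    have h1 := (h.rpow hB.nonneg (-1)).smul (Real.exp c)
    have h2 : CFC.log (Real.exp c • B ^ (-1 : ℝ)) = c • 𝟙 + (-1 : ℝ) • CFC.log B := by
      refine ((h1.log hnn.isSelfAdjoint).congr fun i => ?_).unique
        (((isEigenbasis_one b).smul c).add ((h.log hB.isSelfAdjoint).smul (-1)))
      have := h.pos hB i
      rw [Real.log_mul (by positivity) (by positivity), Real.log_exp, Real.log_rpow this]
      ring
    rw [← h2]
    refine CFC.log_le_log hBA' (h1.isStrictlyPositive hnn.isSelfAdjoint fun i => ?_)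
    have := h.pos hB i
    positivity
  have hlog' : c • 𝟙 ≤ CFC.log A' + CFC.log B := by
    have := add_le_add_left hlog (CFC.log B)
    simpa using this
  refine (sum_posPart_le_opTrace hx (add_le_add_left (CFC.log_le_log hAA' hA) _) hlog').trans
    (le_of_eq ?_)
  rw [opTrace_add, hA', opTrace_log_conj hY'pos (hBr _), log_rpow' hB, opTrace_smul,
    ← hy.opTrace_log_truncation hYpos c]
  ring

/-- **Araki–Lieb–Thirring inequality.** -/
theorem opTrace_rpow_conj_rpow_le {A B : H →L[ℂ] H} (hA : IsStrictlyPositive A)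
    (hB : IsStrictlyPositive B) {θ : ℝ} (hθ0 : 0 < θ) (hθ1 : θ ≤ 1) {q : ℝ} (hq : 0 ≤ q) :
    opTrace ((B ^ (θ / 2) * A ^ θ * B ^ (θ / 2)) ^ q)
      ≤ opTrace ((B ^ (1 / 2 : ℝ) * A * B ^ (1 / 2 : ℝ)) ^ (θ * q)) := by
  have hM : IsStrictlyPositive (B ^ (θ / 2) * A ^ θ * B ^ (θ / 2)) :=
    (hA.rpow A θ).conj (hB.rpow _ _)
  have hY : IsStrictlyPositive (B ^ (1 / 2 : ℝ) * A * B ^ (1 / 2 : ℝ)) := hA.conj (hB.rpow _ _)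
  obtain ⟨b, x, hx⟩ := exists_isEigenbasis hM.isSelfAdjoint
  obtain ⟨b', y, hy⟩ := exists_isEigenbasis hY.isSelfAdjoint
  have := sum_exp_le_sum_exp_of_sum_posPart_le
    (sum_posPart_log_conj_rpow_le hA hB hθ0 hθ1 hx hy) hq
  rw [(hx.rpow hM.nonneg q).opTrace, (hy.rpow hY.nonneg (θ * q)).opTrace]
  convert! this using 2 with i _ i
  · rw [Real.rpow_def_of_pos (hx.pos hM i), mul_comm]
  · rw [Real.rpow_def_of_pos (hy.pos hY i)]
    ring_nf

/-- A form of the **Golden–Thompson inequality**. -/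
theorem opTrace_exp_smul_log_add_log_le {A B : H →L[ℂ] H} (hA : IsStrictlyPositive A)
    (hB : IsStrictlyPositive B) {q : ℝ} (hq : 0 ≤ q) :
    opTrace (NormedSpace.exp (q • (CFC.log A + CFC.log B)))
      ≤ opTrace ((B ^ (1 / 2 : ℝ) * A * B ^ (1 / 2 : ℝ)) ^ q) := by
  have hM : IsSelfAdjoint (CFC.log A + CFC.log B) := IsSelfAdjoint.log.add IsSelfAdjoint.log
  have hY : IsStrictlyPositive (B ^ (1 / 2 : ℝ) * A * B ^ (1 / 2 : ℝ)) := hA.conj (hB.rpow _ _)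
  obtain ⟨b, x, hx⟩ := exists_isEigenbasis hM
  obtain ⟨b', y, hy⟩ := exists_isEigenbasis hY.isSelfAdjoint
  have := sum_exp_le_sum_exp_of_sum_posPart_le (sum_posPart_add_le hA hB hx hy) hq
  rw [((hx.smul q).exp ((IsSelfAdjoint.all q).smul hM)).opTrace, (hy.rpow hY.nonneg q).opTrace]
  convert! this using 2 with i
  rw [Real.rpow_def_of_pos (hy.pos hY i), mul_comm]

theorem renyiQPosDef_petz_eq {ρ σ : H →L[ℂ] H} (hρ : IsStrictlyPositive ρ) (α : ℝ) :
    renyiQPosDef .petz α ρ σ = opTrace (ρ ^ (α / 2) * σ ^ (1 - α) * ρ ^ (α / 2)) := by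
  have : ρ ^ α = ρ ^ (α / 2) * ρ ^ (α / 2) := by
    rw [← CFC.rpow_add hρ.isUnit, add_halves]
  rw [renyiQPosDef, this, mul_assoc, opTrace_mul_comm]

theorem renyiQPosDef_petz_le_sandwiched {ρ σ : H →L[ℂ] H} (hρ : IsStrictlyPositive ρ)
    (hσ : IsStrictlyPositive σ) {α : ℝ} (h0 : 0 < α) (h1 : α < 1) :
    renyiQPosDef .petz α ρ σ ≤ renyiQPosDef .sandwiched α ρ σ := by
  -- Araki–Lieb–Thirring with `θ = α`, `A = σ^((1-α)/α)`, `B = ρ`.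
  have h := opTrace_rpow_conj_rpow_le (hσ.rpow σ ((1 - α) / α)) hρ h0 h1.le (q := 1) zero_le_one
  have h2 := ((hσ.rpow σ (1 - α)).conj (hρ.rpow ρ (α / 2))).nonneg
  rw [rpow_rpow_of_isStrictlyPositive hσ, mul_one, div_mul_cancel₀ _ h0.ne',
    CFC.rpow_one _ h2] at h
  rw [renyiQPosDef_petz_eq hρ]
  exact h

theorem renyiQPosDef_sandwiched_le_petz {ρ σ : H →L[ℂ] H} (hρ : IsStrictlyPositive ρ)
    (hσ : IsStrictlyPositive σ) {α : ℝ} (h1 : 1 < α) :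
    renyiQPosDef .sandwiched α ρ σ ≤ renyiQPosDef .petz α ρ σ := by
  have h0 : 0 < α := by linarith
  -- Araki–Lieb–Thirring with `θ = 1/α`, `A = σ^(1-α)`, `B = ρ^α`, `q = α`; the sandwiched trace is
  -- now the smaller side.
  have h := opTrace_rpow_conj_rpow_le (hσ.rpow σ (1 - α)) (hρ.rpow ρ α) (inv_pos.2 h0)
    (inv_le_one_of_one_le₀ h1.le) h0.le
  have h2 := ((hσ.rpow σ (1 - α)).conj (hρ.rpow ρ (α / 2))).nonneg
  simp only [rpow_rpow_of_isStrictlyPositive hσ, rpow_rpow_of_isStrictlyPositive hρ] at h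
  rw [inv_mul_cancel₀ h0.ne', mul_one_div, CFC.rpow_one _ h2, mul_div_assoc',
    mul_inv_cancel₀ h0.ne', ← div_eq_mul_inv] at h
  rw [renyiQPosDef_petz_eq hρ]
  exact h

theorem renyiQPosDef_logEuclidean_le_petz {ρ σ : H →L[ℂ] H} (hρ : IsStrictlyPositive ρ)
    (hσ : IsStrictlyPositive σ) (α : ℝ) :
    renyiQPosDef .logEuclidean α ρ σ ≤ renyiQPosDef .petz α ρ σ := by
  have h := opTrace_exp_smul_log_add_log_le (hσ.rpow σ (1 - α)) (hρ.rpow ρ α) zero_le_one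
  have h2 : IsStrictlyPositive ((ρ ^ α) ^ (1 / 2 : ℝ) * σ ^ (1 - α) * (ρ ^ α) ^ (1 / 2 : ℝ)) :=
    (hσ.rpow _ _).conj ((hρ.rpow _ _).rpow _ _)
  rw [one_smul, log_rpow' hσ, log_rpow' hρ, CFC.rpow_one _ h2.nonneg, add_comm,
    rpow_rpow_of_isStrictlyPositive hρ, mul_one_div] at h
  rw [renyiQPosDef_petz_eq hρ]
  exact h

theorem renyiQPosDef_logEuclidean_le_sandwiched {ρ σ : H →L[ℂ] H} (hρ : IsStrictlyPositive ρ)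
    (hσ : IsStrictlyPositive σ) {α : ℝ} (h0 : 0 < α) :
    renyiQPosDef .logEuclidean α ρ σ ≤ renyiQPosDef .sandwiched α ρ σ := by
  have h := opTrace_exp_smul_log_add_log_le (hσ.rpow σ ((1 - α) / α)) hρ h0.le
  rw [log_rpow' hσ, smul_add, smul_smul, mul_div_cancel₀ _ h0.ne', add_comm] at h
  exact h

end Majorization

/-! ### Monotonicity in `α` for positive definite operators. -/

section AlphaMonotonicity

variable {ι κ : Type*} [Fintype ι] [Fintype κ]

/-- Hölder's inequality, by normalising with `e^(-A)`, `e^(-B)` and using convexity of `exp`. Upper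
bounds as hypotheses, rather than equalities, leave room for Peierls' inequality. -/
theorem sum_mul_exp_convexCombo_le {w a b : ι → ℝ} (hw : ∀ k, 0 ≤ w k) {A B s t : ℝ} (hs : 0 ≤ s)
    (ht : 0 ≤ t) (hst : s + t = 1) (hA : ∑ k, w k * Real.exp (a k) ≤ Real.exp A)
    (hB : ∑ k, w k * Real.exp (b k) ≤ Real.exp B) :
    ∑ k, w k * Real.exp (s * a k + t * b k) ≤ Real.exp (s * A + t * B) := by
  have h1 : ∑ k, w k * Real.exp (s * a k + t * b k) ≤
      Real.exp (s * A + t * B) * (s * (Real.exp (-A) * ∑ k, w k * Real.exp (a k))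
        + t * (Real.exp (-B) * ∑ k, w k * Real.exp (b k))) := by
    simp only [Finset.mul_sum, ← Finset.sum_add_distrib]
    refine Finset.sum_le_sum fun k _ => ?_
    have h2 := convexOn_exp.2 (Set.mem_univ (a k - A)) (Set.mem_univ (b k - B)) hs ht hst
    simp only [smul_eq_mul] at h2
    have h3 : Real.exp (s * a k + t * b k) = Real.exp (s * A + t * B) *
        Real.exp (s * (a k - A) + t * (b k - B)) := by
      rw [← Real.exp_add]; ring_nf
    have h4 : Real.exp (a k - A) = Real.exp (-A) * Real.exp (a k) := by
      rw [← Real.exp_add]; ring_nf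
    have h5 : Real.exp (b k - B) = Real.exp (-B) * Real.exp (b k) := by
      rw [← Real.exp_add]; ring_nf
    rw [h4, h5] at h2
    calc w k * Real.exp (s * a k + t * b k)
        = w k * Real.exp (s * A + t * B) * Real.exp (s * (a k - A) + t * (b k - B)) := by
          rw [h3]; ring
      _ ≤ w k * Real.exp (s * A + t * B) * (s * (Real.exp (-A) * Real.exp (a k)) +
          t * (Real.exp (-B) * Real.exp (b k))) :=
          mul_le_mul_of_nonneg_left h2 (mul_nonneg (hw k) (Real.exp_pos _).le)
      _ = _ := by ring
  refine h1.trans ?_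
  have h6 : Real.exp (-A) * ∑ k, w k * Real.exp (a k) ≤ 1 := by
    calc _ ≤ Real.exp (-A) * Real.exp A := by gcongr
      _ = 1 := by rw [← Real.exp_add]; simp
  have h7 : Real.exp (-B) * ∑ k, w k * Real.exp (b k) ≤ 1 := by
    calc _ ≤ Real.exp (-B) * Real.exp B := by gcongr
      _ = 1 := by rw [← Real.exp_add]; simp
  calc _ ≤ Real.exp (s * A + t * B) * (s * 1 + t * 1) := by gcongr
    _ = _ := by rw [mul_one, mul_one, hst, mul_one]

theorem convexOn_log_sum_exp {w : ι → ℝ} (hw : ∀ k, 0 ≤ w k) (hw0 : ∃ k, 0 < w k) (c d : ι → ℝ) :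
    ConvexOn ℝ Set.univ (fun u : ℝ => Real.log (∑ k, w k * Real.exp (u * c k + d k))) := by
  have hpos : ∀ u : ℝ, 0 < ∑ k, w k * Real.exp (u * c k + d k) := fun u => by
    obtain ⟨k, hk⟩ := hw0
    exact Finset.sum_pos' (fun i _ => mul_nonneg (hw i) (Real.exp_pos _).le)
      ⟨k, Finset.mem_univ k, mul_pos hk (Real.exp_pos _)⟩
  refine ⟨convex_univ, fun x _ y _ s t hs ht hst => ?_⟩
  simp only [smul_eq_mul]
  rw [Real.log_le_iff_le_exp (hpos _)]
  refine le_trans (le_of_eq ?_) (sum_mul_exp_convexCombo_le hw hs ht hst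
    (Real.exp_log (hpos x)).ge (Real.exp_log (hpos y)).ge)
  refine Finset.sum_congr rfl fun k _ => ?_
  congr 2
  linear_combination (-d k) * hst

variable {H : Type*} [NormedAddCommGroup H] [InnerProductSpace ℂ H]

/-- Jensen's inequality for the spectral distribution of `S` in the unit vector `v`. -/
theorem IsEigenbasis.map_quadForm_le {S : H →L[ℂ] H} {b : OrthonormalBasis ι ℂ H} {l : ι → ℝ}
    (h : IsEigenbasis S b l) {f : ℝ → ℝ} {s : Set ℝ} (hf : ConvexOn ℝ s f) (hl : ∀ i, l i ∈ s)
    {v : H} (hv : ‖v‖ = 1) :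
    f (_root_.quadForm S v) ≤ ∑ i, ‖inner ℂ (b i) v‖ ^ 2 * f (l i) := by
  rw [h.quadForm_eq]
  have := hf.map_sum_le (t := Finset.univ) (w := fun i => ‖inner ℂ (b i) v‖ ^ 2) (p := l)
    (fun i _ => by positivity) (by rw [b.sum_sq_norm_inner_right, hv, one_pow]) fun i _ => hl i
  simpa using this

theorem quadForm_conj {A B : H →L[ℂ] H} [CompleteSpace H] (hB : IsSelfAdjoint B) (v : H) :
    quadForm (B * A * B) v = quadForm A (B v) := by
  simp only [quadForm, mul_apply_eq_comp]
  rw [← ContinuousLinearMap.adjoint_inner_left, hB.adjoint_eq]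

theorem IsEigenbasis.opTrace_mul {A B : H →L[ℂ] H} [CompleteSpace H] (hA : IsSelfAdjoint A)
    {b : OrthonormalBasis ι ℂ H} {l : ι → ℝ} (h : IsEigenbasis A b l) :
    _root_.opTrace (A * B) = ∑ i, l i * _root_.quadForm B (b i) := by
  rw [opTrace_eq_sum _ b]
  refine Finset.sum_congr rfl fun i _ => ?_
  simp only [_root_.quadForm, mul_apply_eq_comp]
  rw [← ContinuousLinearMap.adjoint_inner_left, hA.adjoint_eq, h i, ← Complex.coe_smul,
    inner_smul_left, Complex.conj_ofReal, Complex.re_ofReal_mul]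

variable [FiniteDimensional ℂ H] [CompleteSpace H]

theorem opTrace_pos [Nontrivial H] {A : H →L[ℂ] H} (hA : IsStrictlyPositive A) : 0 < opTrace A := by
  obtain ⟨b, l, h⟩ := exists_isEigenbasis hA.isSelfAdjoint
  have : Nonempty (Fin (Module.finrank ℂ H)) := ⟨⟨0, Module.finrank_pos⟩⟩
  rw [h.opTrace]
  exact Finset.sum_pos (fun i _ => h.pos hA i) Finset.univ_nonempty

theorem quadForm_pos {A : H →L[ℂ] H} (hA : IsStrictlyPositive A) {v : H} (hv : v ≠ 0) :
    0 < quadForm A v := by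
  obtain ⟨b, l, h⟩ := exists_isEigenbasis hA.isSelfAdjoint
  rw [h.quadForm_eq]
  have h1 : 0 < ∑ i, ‖inner ℂ (b i) v‖ ^ 2 := by
    rw [b.sum_sq_norm_inner_right]; positivity
  obtain ⟨i, hi, hi0⟩ := (Finset.sum_pos_iff_of_nonneg fun i _ => by positivity).1 h1
  exact Finset.sum_pos' (fun j _ => mul_nonneg (by positivity) (h.pos hA j).le)
    ⟨i, hi, mul_pos hi0 (h.pos hA i)⟩

/-- **Peierls inequality.** -/
theorem sum_exp_quadForm_le (b : OrthonormalBasis ι ℂ H) {S : H →L[ℂ] H} (hS : IsSelfAdjoint S) :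
    ∑ i, Real.exp (quadForm S (b i)) ≤ opTrace (NormedSpace.exp S) := by
  obtain ⟨e, l, h⟩ := exists_isEigenbasis hS
  rw [opTrace_eq_sum _ b]
  refine Finset.sum_le_sum fun i _ => ?_
  rw [(h.exp hS).quadForm_eq]
  exact h.map_quadForm_le convexOn_exp (fun _ => Set.mem_univ _) (b.norm_eq_one i)

theorem sum_quadForm_rpow_le (b : OrthonormalBasis ι ℂ H) {S : H →L[ℂ] H} (hS : 0 ≤ S) {p : ℝ}
    (hp : 1 ≤ p) : ∑ i, quadForm S (b i) ^ p ≤ opTrace (S ^ p) := by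
  obtain ⟨e, l, h⟩ := exists_isEigenbasis hS.isSelfAdjoint
  rw [opTrace_eq_sum _ b]
  refine Finset.sum_le_sum fun i _ => ?_
  rw [(h.rpow hS p).quadForm_eq]
  exact h.map_quadForm_le (convexOn_rpow hp) (fun i => h.nonneg hS i) (b.norm_eq_one i)

theorem opTrace_rpow_le_sum_quadForm_rpow (b : OrthonormalBasis ι ℂ H) {S : H →L[ℂ] H} (hS : 0 ≤ S)
    {p : ℝ} (hp0 : 0 ≤ p) (hp : p ≤ 1) : opTrace (S ^ p) ≤ ∑ i, quadForm S (b i) ^ p := by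
  obtain ⟨e, l, h⟩ := exists_isEigenbasis hS.isSelfAdjoint
  rw [opTrace_eq_sum _ b]
  refine Finset.sum_le_sum fun i _ => ?_
  rw [(h.rpow hS p).quadForm_eq]
  have := h.map_quadForm_le (Real.concaveOn_rpow hp0 hp).neg (fun i => h.nonneg hS i)
    (b.norm_eq_one i)
  simpa using this

theorem renyiQPosDef_petz_eq_sum {ρ σ : H →L[ℂ] H} (hρ : 0 ≤ ρ) (hσ : 0 ≤ σ)
    {b : OrthonormalBasis ι ℂ H} {l : ι → ℝ} (hb : IsEigenbasis ρ b l)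
    {f : OrthonormalBasis κ ℂ H} {m : κ → ℝ} (hf : IsEigenbasis σ f m) (α : ℝ) :
    renyiQPosDef .petz α ρ σ
      = ∑ p : ι × κ, ‖inner ℂ (f p.2) (b p.1)‖ ^ 2 * (l p.1 ^ α * m p.2 ^ (1 - α)) := by
  rw [renyiQPosDef, (hb.rpow hρ α).opTrace_mul CFC.rpow_nonneg.isSelfAdjoint,
    Fintype.sum_prod_type]
  refine Finset.sum_congr rfl fun i _ => ?_
  rw [(hf.rpow hσ (1 - α)).quadForm_eq, Finset.mul_sum]
  exact Finset.sum_congr rfl fun j _ => by ring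

theorem convexOn_log_petz [Nontrivial H] {ρ σ : H →L[ℂ] H} (hρ : IsStrictlyPositive ρ)
    (hσ : IsStrictlyPositive σ) :
    ConvexOn ℝ Set.univ (fun α => Real.log (renyiQPosDef .petz α ρ σ)) := by
  obtain ⟨b, l, hb⟩ := exists_isEigenbasis hρ.isSelfAdjoint
  obtain ⟨f, m, hf⟩ := exists_isEigenbasis hσ.isSelfAdjoint
  let i0 : Fin (Module.finrank ℂ H) := ⟨0, Module.finrank_pos⟩
  have h1 : 0 < ∑ j, ‖inner ℂ (f j) (b i0)‖ ^ 2 := by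
    rw [f.sum_sq_norm_inner_right, b.norm_eq_one]; norm_num
  obtain ⟨j, -, hj⟩ := (Finset.sum_pos_iff_of_nonneg fun i _ => by positivity).1 h1
  have := convexOn_log_sum_exp
    (w := fun p : Fin (Module.finrank ℂ H) × Fin (Module.finrank ℂ H) =>
      ‖inner ℂ (f p.2) (b p.1)‖ ^ 2) (fun p => by positivity) ⟨(i0, j), hj⟩
    (fun p => Real.log (l p.1) - Real.log (m p.2)) (fun p => Real.log (m p.2))
  convert! this using 4 with α
  rw [renyiQPosDef_petz_eq_sum hρ.nonneg hσ.nonneg hb hf]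
  refine Finset.sum_congr rfl fun p _ => ?_
  rw [Real.rpow_def_of_pos (hb.pos hρ p.1), Real.rpow_def_of_pos (hf.pos hσ p.2), ← Real.exp_add]
  ring_nf

theorem isSelfAdjoint_logEuclidean_exponent (α : ℝ) (ρ σ : H →L[ℂ] H) :
    IsSelfAdjoint (α • CFC.log ρ + (1 - α) • CFC.log σ) :=
  ((IsSelfAdjoint.all α).smul IsSelfAdjoint.log).add
    ((IsSelfAdjoint.all (1 - α)).smul IsSelfAdjoint.log)

theorem renyiQPosDef_pos [Nontrivial H] {ρ σ : H →L[ℂ] H} (hρ : IsStrictlyPositive ρ)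
    (hσ : IsStrictlyPositive σ) (t : RenyiFamily) (α : ℝ) : 0 < renyiQPosDef t α ρ σ := by
  cases t with
  | petz =>
    rw [renyiQPosDef_petz_eq hρ]
    exact opTrace_pos ((hσ.rpow _ _).conj (hρ.rpow _ _))
  | sandwiched => exact opTrace_pos (((hσ.rpow _ _).conj (hρ.rpow _ _)).rpow _ _)
  | logEuclidean =>
    exact opTrace_pos (isStrictlyPositive_exp (isSelfAdjoint_logEuclidean_exponent α ρ σ))

theorem convexOn_log_logEuclidean [Nontrivial H] {ρ σ : H →L[ℂ] H} (hρ : IsStrictlyPositive ρ)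
    (hσ : IsStrictlyPositive σ) :
    ConvexOn ℝ Set.univ (fun α => Real.log (renyiQPosDef .logEuclidean α ρ σ)) := by
  refine ⟨convex_univ, fun x _ y _ s t hs ht hst => ?_⟩
  have hpos := renyiQPosDef_pos hρ hσ .logEuclidean
  simp only [smul_eq_mul]
  rw [Real.log_le_iff_le_exp (hpos _)]
  have hsa := isSelfAdjoint_logEuclidean_exponent (H := H)
  -- In the eigenbasis at the intermediate parameter Peierls is an equality there and an upper bound
  -- for the diagonal sums at `x` and `y`. Since the exponent is affine in `α`, scalar Hölder
  -- concludes.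
  obtain ⟨b, l, hb⟩ := exists_isEigenbasis (hsa (s * x + t * y) ρ σ)
  have hq := fun z => sum_exp_quadForm_le b (hsa z ρ σ)
  have h1 := sum_mul_exp_convexCombo_le (w := fun _ => 1)
    (a := fun i => quadForm (x • CFC.log ρ + (1 - x) • CFC.log σ) (b i))
    (b := fun i => quadForm (y • CFC.log ρ + (1 - y) • CFC.log σ) (b i))
    (fun _ => zero_le_one) hs ht hst
    (A := Real.log (renyiQPosDef .logEuclidean x ρ σ))
    (B := Real.log (renyiQPosDef .logEuclidean y ρ σ))
    (by rw [Real.exp_log (hpos x)]; simp only [one_mul]; exact hq x)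
    (by rw [Real.exp_log (hpos y)]; simp only [one_mul]; exact hq y)
  refine le_trans (le_of_eq ?_) h1
  rw [renyiQPosDef, (hb.exp (hsa _ ρ σ)).opTrace]
  refine Finset.sum_congr rfl fun i _ => ?_
  rw [one_mul, ← hb.quadForm i]
  simp only [quadForm_add, quadForm_smul]
  congr 1
  linear_combination (-quadForm (CFC.log σ) (b i)) * hst

theorem renyiQPosDef_petz_one {ρ σ : H →L[ℂ] H} (hρ : 0 ≤ ρ) (hσ : 0 ≤ σ) :
    renyiQPosDef .petz 1 ρ σ = opTrace ρ := by
  rw [renyiQPosDef, sub_self, CFC.rpow_zero σ hσ, CFC.rpow_one ρ hρ, mul_one]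

theorem renyiQPosDef_logEuclidean_one {ρ σ : H →L[ℂ] H} (hρ : IsStrictlyPositive ρ) :
    renyiQPosDef .logEuclidean 1 ρ σ = opTrace ρ := by
  rw [renyiQPosDef, sub_self, zero_smul, one_smul, add_zero, CFC.exp_log ρ]

/-- Jensen for `t ↦ t ^ p` with weights `τ k` at the points `τ k ^ (-1/p) * x k`. It is one half of
the variational formula for the `p`-norm; `sum_rpow_le_rpow_sum_mul` is the reversed version for `p
≤ 1`. -/
theorem rpow_sum_mul_le_sum_rpow {τ x : ι → ℝ} (hτ : ∀ k, 0 < τ k) (hτ1 : ∑ k, τ k = 1)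
    (hx : ∀ k, 0 < x k) {p : ℝ} (hp : 1 ≤ p) :
    (∑ k, τ k ^ ((p - 1) / p) * x k) ^ p ≤ ∑ k, x k ^ p := by
  have hp0 : p ≠ 0 := by linarith
  have h := Real.rpow_arith_mean_le_arith_mean_rpow Finset.univ τ
    (fun k => τ k ^ (-1 / p) * x k) (fun k _ => (hτ k).le) hτ1
    (fun k _ => mul_nonneg (Real.rpow_nonneg (hτ k).le _) (hx k).le) hp
  convert! h using 2
  · refine Finset.sum_congr rfl fun k _ => ?_
    rw [← mul_assoc]
    congr 1
    nth_rw 2 [← Real.rpow_one (τ k)]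
    rw [← Real.rpow_add (hτ k)]
    congr 1
    field_simp
    ring
  · rw [Real.mul_rpow (Real.rpow_nonneg (hτ _).le _) (hx _).le, ← Real.rpow_mul (hτ _).le,
      div_mul_cancel₀ _ hp0, Real.rpow_neg_one, ← mul_assoc, mul_inv_cancel₀ (hτ _).ne', one_mul]

theorem sum_rpow_le_rpow_sum_mul {τ x : ι → ℝ} (hτ : ∀ k, 0 < τ k) (hτ1 : ∑ k, τ k = 1)
    (hx : ∀ k, 0 < x k) {p : ℝ} (hp0 : 0 < p) (hp : p ≤ 1) :
    ∑ k, x k ^ p ≤ (∑ k, τ k ^ ((p - 1) / p) * x k) ^ p := by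
  have h := (Real.concaveOn_rpow hp0.le hp).le_map_sum (t := Finset.univ) (w := τ)
    (p := fun k => τ k ^ (-1 / p) * x k) (fun k _ => (hτ k).le) hτ1
    (fun k _ => mul_nonneg (Real.rpow_nonneg (hτ k).le _) (hx k).le)
  simp only [smul_eq_mul] at h
  convert! h using 2
  · rw [Real.mul_rpow (Real.rpow_nonneg (hτ _).le _) (hx _).le, ← Real.rpow_mul (hτ _).le,
      div_mul_cancel₀ _ hp0.ne', Real.rpow_neg_one, ← mul_assoc, mul_inv_cancel₀ (hτ _).ne',
      one_mul]
  · refine Finset.sum_congr rfl fun k _ => ?_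
    rw [← mul_assoc]
    congr 1
    nth_rw 2 [← Real.rpow_one (τ k)]
    rw [← Real.rpow_add (hτ k)]
    congr 1
    field_simp
    ring

/-- With `u = (α-1)/α` and `X u = ρ^(1/2) σ^(-u) ρ^(1/2)`, the quantity `(1/α) log Q*_α` is the
logarithm of the `α`-norm (a quasi-norm if `α < 1`) of `X u`. Freezing the weights `τ` optimal at
`α` yields a log-sum-exp function `φ`, convex in the new parameter, exact at `0` and `u`, and at `v`
on the favourable side of the true value. The secant slopes of `φ` at `0` then give the claim. -/
theorem secant_log_sandwiched_mono [Nontrivial H] {ρ σ : H →L[ℂ] H} (hρ : IsStrictlyPositive ρ)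
    (hσ : IsStrictlyPositive σ) {α β : ℝ} (h0 : 0 < α) (hα : α ≠ 1) (hβ : β ≠ 1) (hαβ : α ≤ β) :
    (Real.log (renyiQPosDef .sandwiched α ρ σ) - Real.log (opTrace ρ)) / (α - 1)
      ≤ (Real.log (renyiQPosDef .sandwiched β ρ σ) - Real.log (opTrace ρ)) / (β - 1) := by
  have h0' : 0 < β := h0.trans_le hαβ
  set X : ℝ → H →L[ℂ] H := fun u => ρ ^ (1 / 2 : ℝ) * σ ^ (-u) * ρ ^ (1 / 2 : ℝ) with hX
  have hXpos : ∀ u, IsStrictlyPositive (X u) := fun u => (hσ.rpow _ _).conj (hρ.rpow _ _)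
  have hQ : ∀ a, renyiQPosDef .sandwiched a ρ σ = opTrace (X ((a - 1) / a) ^ a) := fun a => by
    simp only [renyiQPosDef, hX, ← neg_div, neg_sub]
  set u := (α - 1) / α with hu
  set v := (β - 1) / β with hv
  obtain ⟨f, m, hf⟩ := exists_isEigenbasis hσ.isSelfAdjoint
  obtain ⟨t, x, ht⟩ := exists_isEigenbasis (hXpos u).isSelfAdjoint
  have hx := ht.pos (hXpos u)
  set Q := opTrace (X u ^ α) with hQdef
  have hQpos : 0 < Q := opTrace_pos ((hXpos u).rpow _ _)
  have hQsum : Q = ∑ k, x k ^ α := (ht.rpow (hXpos u).nonneg α).opTrace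
  -- The equality case of Hölder for the eigenvalues of `X u`, which makes `hφu` exact.
  set τ := fun k => x k ^ α / Q with hτdef
  have hτ : ∀ k, 0 < τ k := fun k => div_pos (Real.rpow_pos_of_pos (hx k) _) hQpos
  have hτ1 : ∑ k, τ k = 1 := by
    rw [← Finset.sum_div, ← hQsum, div_self hQpos.ne']
  set w : Fin (Module.finrank ℂ H) × Fin (Module.finrank ℂ H) → ℝ :=
    fun p => ‖inner ℂ (f p.2) ((ρ ^ (1 / 2 : ℝ)) (t p.1))‖ ^ 2 with hw
  set φ : ℝ → ℝ := fun r => Real.log (∑ p, w p *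
    Real.exp (r * (Real.log (τ p.1) - Real.log (m p.2)) + 0)) with hφ
  have hsum : ∀ r, ∑ p, w p * Real.exp (r * (Real.log (τ p.1) - Real.log (m p.2)) + 0)
      = ∑ k, τ k ^ r * quadForm (X r) (t k) := fun r => by
    rw [Fintype.sum_prod_type]
    refine Finset.sum_congr rfl fun k _ => ?_
    rw [hX, quadForm_conj CFC.rpow_nonneg.isSelfAdjoint, (hf.rpow hσ.nonneg _).quadForm_eq,
      Finset.mul_sum]
    refine Finset.sum_congr rfl fun j _ => ?_
    rw [Real.rpow_def_of_pos (hτ k), Real.rpow_def_of_pos (hf.pos hσ j), mul_left_comm,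
      ← Real.exp_add, mul_comm]
    simp only [hw]
    ring_nf
  have htne : ∀ k, t k ≠ 0 := fun k => t.orthonormal.ne_zero k
  have hqpos : ∀ r k, 0 < quadForm (X r) (t k) := fun r k => quadForm_pos (hXpos r) (htne k)
  let i0 : Fin (Module.finrank ℂ H) := ⟨0, Module.finrank_pos⟩
  have hsumpos : ∀ r, 0 < ∑ k, τ k ^ r * quadForm (X r) (t k) := fun r =>
    Finset.sum_pos (fun k _ => mul_pos (Real.rpow_pos_of_pos (hτ k) _) (hqpos r k)) ⟨i0, Finset.mem_univ _⟩
  have hw0 : ∃ p, 0 < w p := by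
    have := hsumpos 0
    rw [← hsum] at this
    obtain ⟨p, -, hp⟩ := (Finset.sum_pos_iff_of_nonneg fun p _ =>
      mul_nonneg (by positivity) (Real.exp_pos _).le).1 this
    exact ⟨p, pos_of_mul_pos_left hp (Real.exp_pos _).le⟩
  have hconv : ConvexOn ℝ Set.univ φ := convexOn_log_sum_exp (fun p => by positivity) hw0 _ _
  have hφ0 : φ 0 = Real.log (opTrace ρ) := by
    simp only [hφ, hsum]
    have hX0 : X 0 = ρ := by
      simp only [hX, neg_zero]
      rw [CFC.rpow_zero σ hσ.nonneg, mul_one, ← CFC.rpow_add hρ.isUnit, add_halves,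
        CFC.rpow_one ρ hρ.nonneg]
    rw [hX0, opTrace_eq_sum ρ t]
    simp
  have hφu : φ u = 1 / α * Real.log Q := by
    simp only [hφ, hsum]
    rw [← Real.log_rpow hQpos]
    congr 1
    have : ∀ k, τ k ^ u * quadForm (X u) (t k) = x k ^ α * (Q ^ u)⁻¹ := fun k => by
      rw [ht.quadForm k, hτdef, Real.div_rpow (Real.rpow_nonneg (hx k).le _) hQpos.le,
        ← Real.rpow_mul (hx k).le, hu, mul_div_cancel₀ _ h0.ne', Real.rpow_sub_one (hx k).ne']
      have := (hx k).ne'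
      field_simp
    rw [Finset.sum_congr rfl fun k _ => this k, ← Finset.sum_mul, ← hQsum, ← Real.rpow_neg hQpos.le]
    nth_rw 1 [← Real.rpow_one Q]
    rw [← Real.rpow_add hQpos, hu]
    congr 1
    field_simp
    ring
  have hu0 : u ≠ 0 := div_ne_zero (sub_ne_zero.2 hα) h0.ne'
  have hv0 : v ≠ 0 := div_ne_zero (sub_ne_zero.2 hβ) h0'.ne'
  have huv : u ≤ v := by
    rw [hu, hv, div_le_div_iff₀ h0 h0']
    nlinarith
  have hsec := hconv.secant_mono (Set.mem_univ 0) (Set.mem_univ u) (Set.mem_univ v) hu0 hv0 huv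
  have hR : 0 < opTrace (X v ^ β) := opTrace_pos ((hXpos v).rpow _ _)
  have hlast : (φ v - φ 0) / v ≤ (1 / β * Real.log (opTrace (X v ^ β)) - φ 0) / v := by
    have hS := hsumpos v
    -- For `β < 1` both trace inequalities reverse, and so does division by `v < 0`; the two effects
    -- compensate.
    rcases lt_or_gt_of_ne hβ with hβ1 | hβ1
    · have hvneg : v < 0 := div_neg_of_neg_of_pos (by linarith) h0'
      refine div_le_div_of_nonpos_of_le hvneg.le (sub_le_sub_right ?_ _)
      simp only [hφ, hsum]
      rw [one_div, inv_mul_le_iff₀ h0', ← Real.log_rpow hS]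
      refine Real.log_le_log hR ?_
      exact (opTrace_rpow_le_sum_quadForm_rpow t (hXpos v).nonneg h0'.le hβ1.le).trans
        (sum_rpow_le_rpow_sum_mul hτ hτ1 (hqpos v) h0' hβ1.le)
    · have hvpos : 0 < v := div_pos (by linarith) h0'
      refine div_le_div_of_nonneg_right (sub_le_sub_right ?_ _) hvpos.le
      simp only [hφ, hsum]
      rw [one_div, le_inv_mul_iff₀ h0', ← Real.log_rpow hS]
      refine Real.log_le_log (Real.rpow_pos_of_pos hS _) ?_
      exact (rpow_sum_mul_le_sum_rpow hτ hτ1 (hqpos v) hβ1.le).trans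
        (sum_quadForm_rpow_le t (hXpos v).nonneg hβ1.le)
  -- The slope in the variable `(a-1)/a` is the slope in `a` based at `1`, up to the constant `M`.
  have hfin : ∀ a L M : ℝ, 0 < a → a ≠ 1 →
      (1 / a * L - M) / ((a - 1) / a) = (L - M) / (a - 1) - M := fun a L M ha ha1 => by
    have := sub_ne_zero.2 ha1
    field_simp
    ring
  rw [sub_zero, sub_zero] at hsec
  have h := hsec.trans hlast
  rw [hφu, hφ0, hu, hv, hfin α _ _ h0 hα, hfin β _ _ h0' hβ] at h
  rw [hQ, hQ]
  linarith

theorem secant_log_renyiQPosDef_mono [Nontrivial H] {ρ σ : H →L[ℂ] H} (hρ : IsStrictlyPositive ρ)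
    (hσ : IsStrictlyPositive σ) (t : RenyiFamily) {α β : ℝ} (h0 : 0 < α) (hα : α ≠ 1) (hβ : β ≠ 1)
    (hαβ : α ≤ β) :
    (Real.log (renyiQPosDef t α ρ σ) - Real.log (opTrace ρ)) / (α - 1)
      ≤ (Real.log (renyiQPosDef t β ρ σ) - Real.log (opTrace ρ)) / (β - 1) := by
  cases t with
  | petz =>
    have := (convexOn_log_petz hρ hσ).secant_mono (Set.mem_univ 1) (Set.mem_univ α)
      (Set.mem_univ β) hα hβ hαβ
    rwa [renyiQPosDef_petz_one hρ.nonneg hσ.nonneg] at this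
  | sandwiched => exact secant_log_sandwiched_mono hρ hσ h0 hα hβ hαβ
  | logEuclidean =>
    have := (convexOn_log_logEuclidean hρ hσ).secant_mono (Set.mem_univ 1) (Set.mem_univ α)
      (Set.mem_univ β) hα hβ hαβ
    rwa [renyiQPosDef_logEuclidean_one hρ] at this

end AlphaMonotonicity

/-! ### Existence of the limits `ε ↘ 0` in `[0, ∞]`. -/

section Regularisation

variable {ι X : Type*} [Fintype ι]
variable {H : Type*} [NormedAddCommGroup H] [InnerProductSpace ℂ H]

theorem tendsto_const_add_nhdsGT_zero (z : ℝ) :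
    Tendsto (fun ε : ℝ => z + ε) (𝓝[>] 0) (𝓝 z) := by
  have h : Continuous fun ε : ℝ => z + ε := by fun_prop
  have := h.tendsto 0
  rw [add_zero] at this
  exact this.mono_left nhdsWithin_le_nhds

/-- The operator with eigenbasis `b` and eigenvalues `g`. -/
noncomputable def spectralOp (b : OrthonormalBasis ι ℂ H) (g : ι → ℝ) : H →L[ℂ] H :=
  ∑ i, g i • InnerProductSpace.rankOne ℂ (b i) (b i)

theorem isEigenbasis_spectralOp (b : OrthonormalBasis ι ℂ H) (g : ι → ℝ) :
    IsEigenbasis (spectralOp b g) b g := fun i => by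
  classical
  simp [spectralOp, b.inner_eq_ite]

theorem tendsto_spectralOp (b : OrthonormalBasis ι ℂ H) {g : X → ι → ℝ} {g0 : ι → ℝ}
    {l : Filter X} (h : ∀ i, Tendsto (fun x => g x i) l (𝓝 (g0 i))) :
    Tendsto (fun x => spectralOp b (g x)) l (𝓝 (spectralOp b g0)) :=
  tendsto_finsetSum _ fun i _ => (h i).smul_const _

theorem continuous_quadForm (v : H) : Continuous fun A : H →L[ℂ] H => quadForm A v := by
  unfold quadForm
  fun_prop

theorem abs_quadForm_le (A : H →L[ℂ] H) {v : H} (hv : ‖v‖ = 1) : |quadForm A v| ≤ ‖A‖ := by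
  refine (Complex.abs_re_le_norm _).trans ((norm_inner_le_norm _ _).trans ?_)
  have := A.le_opNorm v
  rw [hv, mul_one] at this
  rwa [hv, one_mul]

theorem IsEigenbasis.add_smul_one {A : H →L[ℂ] H} {b : OrthonormalBasis ι ℂ H} {l : ι → ℝ}
    (h : IsEigenbasis A b l) (ε : ℝ) :
    IsEigenbasis (A + ε • (1 : H →L[ℂ] H)) b (fun i => l i + ε) :=
  (h.add ((isEigenbasis_one b).smul ε)).congr fun i => by simp

variable [FiniteDimensional ℂ H] [CompleteSpace H]

theorem isSelfAdjoint_spectralOp (b : OrthonormalBasis ι ℂ H) (g : ι → ℝ) :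
    IsSelfAdjoint (spectralOp b g) := by
  have : ∀ i, IsSelfAdjoint (g i • InnerProductSpace.rankOne ℂ (b i) (b i)) := fun i =>
    (IsSelfAdjoint.all (g i)).smul (InnerProductSpace.isPositive_rankOne_self (b i)).isSelfAdjoint
  unfold spectralOp
  exact isSelfAdjoint_sum _ fun i _ => this i

theorem continuous_opTrace : Continuous (opTrace : (H →L[ℂ] H) → ℝ) := by
  have : (opTrace : (H →L[ℂ] H) → ℝ) =
      fun A => ∑ i, quadForm A (stdOrthonormalBasis ℂ H i) := by
    ext A
    exact opTrace_eq_sum A _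
  rw [this]
  exact continuous_finsetSum _ fun i _ => continuous_quadForm _

theorem continuousOn_rpow_nonneg {p : ℝ} (hp : 0 ≤ p) :
    ContinuousOn (fun A : H →L[ℂ] H => A ^ p) {A | 0 ≤ A} := by
  have h : Continuous fun x : NNReal => x ^ p := NNReal.continuous_rpow_const hp
  exact ContinuousOn.cfc_nnreal_of_mem_nhdsSet (s := Set.univ) (fun x : NNReal => x ^ p)
    Filter.univ_mem continuousOn_id (fun x hx => hx) h.continuousOn

theorem isStrictlyPositive_add_smul_one {A : H →L[ℂ] H} (hA : 0 ≤ A) {ε : ℝ} (hε : 0 < ε) :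
    IsStrictlyPositive (A + ε • (1 : H →L[ℂ] H)) := by
  obtain ⟨b, l, h⟩ := exists_isEigenbasis hA.isSelfAdjoint
  refine (h.add_smul_one ε).isStrictlyPositive
    (hA.isSelfAdjoint.add ((IsSelfAdjoint.all ε).smul (IsSelfAdjoint.one _))) fun i => ?_
  have := h.nonneg hA i
  positivity

theorem exists_tendsto_ofReal_petz_term {w l m a : ℝ} (hw : 0 ≤ w) (hl : 0 ≤ l) (hm : 0 ≤ m)
    (ha : 0 < a) :
    ∃ L, Tendsto (fun ε : ℝ => ENNReal.ofReal (w * ((l + ε) ^ a * (m + ε) ^ (1 - a))))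
      (𝓝[>] 0) (𝓝 L) := by
  have hcont : ∀ (z p : ℝ), z ≠ 0 ∨ 0 ≤ p →
      Tendsto (fun ε : ℝ => (z + ε) ^ p) (𝓝[>] 0) (𝓝 (z ^ p)) := fun z p hz => by
    have h1 := tendsto_const_add_nhdsGT_zero z
    exact h1.rpow_const hz
  have hl' := hcont l a (Or.inr ha.le)
  by_cases hma : m ≠ 0 ∨ 0 ≤ 1 - a
  · exact ⟨_, ENNReal.tendsto_ofReal ((hl'.mul (hcont m _ hma)).const_mul w)⟩
  push Not at hma
  obtain ⟨rfl, ha2⟩ := hma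
  -- What remains is `m = 0` with a negative exponent. If also `l = 0`, the powers combine to `ε`
  -- and the limit is `0`; if `w, l > 0`, the term diverges.
  rcases hw.eq_or_lt with rfl | hw
  · exact ⟨0, by simp⟩
  rcases hl.eq_or_lt with rfl | hl
  · refine ⟨ENNReal.ofReal (w * 0), ENNReal.tendsto_ofReal (Tendsto.const_mul w ?_)⟩
    have h0 : Tendsto (fun ε : ℝ => ε) (𝓝[>] 0) (𝓝 0) := nhdsWithin_le_nhds
    refine h0.congr' ?_
    filter_upwards [self_mem_nhdsWithin] with ε (hε : 0 < ε)
    rw [zero_add, ← Real.rpow_add hε, add_sub_cancel, Real.rpow_one]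
  · refine ⟨∞, ENNReal.tendsto_ofReal_atTop.comp (Tendsto.const_mul_atTop hw ?_)⟩
    simp only [zero_add]
    exact hl'.pos_mul_atTop (Real.rpow_pos_of_pos hl a) (tendsto_rpow_neg_nhdsGT_zero ha2)

theorem exists_tendsto_renyiQReg_petz {ρ σ : H →L[ℂ] H} (hρ : 0 ≤ ρ) (hσ : 0 ≤ σ) {a : ℝ}
    (ha : 0 < a) :
    ∃ L, Tendsto (renyiQReg .petz a ρ σ) (𝓝[>] 0) (𝓝 L) := by
  obtain ⟨b, l, hb⟩ := exists_isEigenbasis hρ.isSelfAdjoint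
  obtain ⟨f, m, hf⟩ := exists_isEigenbasis hσ.isSelfAdjoint
  choose L hL using fun p : Fin (Module.finrank ℂ H) × Fin (Module.finrank ℂ H) =>
    exists_tendsto_ofReal_petz_term (w := ‖inner ℂ (f p.2) (b p.1)‖ ^ 2) (by positivity)
      (hb.nonneg hρ p.1) (hf.nonneg hσ p.2) ha
  refine ⟨∑ p, L p, (tendsto_finsetSum _ fun p _ => hL p).congr' ?_⟩
  filter_upwards [self_mem_nhdsWithin] with ε (hε : 0 < ε)
  rw [renyiQReg, renyiQPosDef_petz_eq_sum (isStrictlyPositive_add_smul_one hρ hε).nonneg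
    (isStrictlyPositive_add_smul_one hσ hε).nonneg (hb.add_smul_one ε) (hf.add_smul_one ε),
    ENNReal.ofReal_sum_of_nonneg]
  intro p _
  have h1 := hb.nonneg hρ p.1
  have h2 := hf.nonneg hσ p.2
  positivity

theorem apply_eq_zero_of_quadForm_eq_zero {A : H →L[ℂ] H} (hA : 0 ≤ A) {v : H}
    (hv : quadForm A v = 0) : A v = 0 := by
  obtain ⟨b, l, h⟩ := exists_isEigenbasis hA.isSelfAdjoint
  rw [h.quadForm_eq, Finset.sum_eq_zero_iff_of_nonneg fun i _ =>
    mul_nonneg (by positivity) (h.nonneg hA i)] at hv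
  rw [← b.sum_repr' v, map_sum]
  refine Finset.sum_eq_zero fun i hi => ?_
  have := hv i hi
  rw [map_smul, h i]
  rcases mul_eq_zero.1 this with h0 | h0
  · rw [sq_eq_zero_iff, norm_eq_zero] at h0
    rw [h0, zero_smul]
  · rw [h0, zero_smul, smul_zero]

theorem tendsto_rpow_add_smul_one {ρ : H →L[ℂ] H} (hρ : 0 ≤ ρ) {p : ℝ} (hp : 0 ≤ p) :
    Tendsto (fun ε : ℝ => (ρ + ε • (1 : H →L[ℂ] H)) ^ p) (𝓝[>] 0) (𝓝 (ρ ^ p)) := by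
  have h := (continuousOn_rpow_nonneg (H := H) hp) ρ hρ
  refine h.tendsto.comp (tendsto_nhdsWithin_iff.2 ⟨?_, ?_⟩)
  · have : Tendsto (fun ε : ℝ => ρ + ε • (1 : H →L[ℂ] H)) (𝓝 0) (𝓝 (ρ + (0 : ℝ) • 1)) := by
      apply Continuous.tendsto
      fun_prop
    rw [zero_smul, add_zero] at this
    exact this.mono_left nhdsWithin_le_nhds
  · filter_upwards [self_mem_nhdsWithin] with ε hε
    exact (isStrictlyPositive_add_smul_one hρ hε).nonneg

/-- In the singular case `m = 0`, `s < 0`, the vector `v` lies in the kernel of `ρ`. Each square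
root then contributes `ε^(1/2)`, and `ε * ε^s → 0` because `s > -1`. -/
theorem exists_tendsto_sandwiched_term {ρ : H →L[ℂ] H} (hρ : 0 ≤ ρ) {v : H} {m s : ℝ}
    (hs : -1 < s) (h : m ≠ 0 ∨ 0 ≤ s ∨ quadForm ρ v = 0) :
    ∃ L, Tendsto (fun ε : ℝ => (m + ε) ^ s • ((ρ + ε • (1 : H →L[ℂ] H)) ^ (1 / 2 : ℝ) *
      InnerProductSpace.rankOne ℂ v v * (ρ + ε • (1 : H →L[ℂ] H)) ^ (1 / 2 : ℝ))) (𝓝[>] 0) (𝓝 L) := by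
  have hR := tendsto_rpow_add_smul_one hρ (p := 1 / 2) (by norm_num)
  by_cases hms : m ≠ 0 ∨ 0 ≤ s
  · have h1 := tendsto_const_add_nhdsGT_zero m
    exact ⟨_, (h1.rpow_const hms).smul ((hR.mul_const _).mul hR)⟩
  push Not at hms
  obtain ⟨rfl, hs0⟩ := hms
  have hv : ρ v = 0 := apply_eq_zero_of_quadForm_eq_zero hρ (by simpa [hs0.not_ge] using h)
  have h0 : Tendsto (fun ε : ℝ => ε ^ (1 + s)) (𝓝[>] 0) (𝓝 0) := by
    have := (Real.continuousAt_rpow_const 0 (1 + s) (Or.inr (by linarith))).tendsto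
    rw [Real.zero_rpow (by linarith)] at this
    exact this.mono_left nhdsWithin_le_nhds
  refine ⟨_, (h0.smul_const (InnerProductSpace.rankOne ℂ v v)).congr' ?_⟩
  filter_upwards [self_mem_nhdsWithin] with ε (hε : 0 < ε)
  have hpos := isStrictlyPositive_add_smul_one hρ hε
  set R := (ρ + ε • (1 : H →L[ℂ] H)) ^ (1 / 2 : ℝ) with hRdef
  have hRsa : IsSelfAdjoint R := CFC.rpow_nonneg.isSelfAdjoint
  have hRv : R v = ε ^ (1 / 2 : ℝ) • v := by
    rw [hRdef, CFC.rpow_eq_cfc_real hpos.nonneg]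
    exact cfc_apply_of_apply_eq_smul hpos.isSelfAdjoint _ (by simp [hv])
  have hconj : R * InnerProductSpace.rankOne ℂ v v * R
      = ε • InnerProductSpace.rankOne ℂ v v := by
    have h2 : ε ^ (1 / 2 : ℝ) * ε ^ (1 / 2 : ℝ) = ε := by
      rw [← Real.rpow_add hε]; norm_num
    ext z
    simp only [mul_apply_eq_comp, InnerProductSpace.rankOne_apply, map_smul, hRv,
      smul_apply]
    rw [← ContinuousLinearMap.adjoint_inner_left, hRsa.adjoint_eq, hRv]
    nth_rw 3 [← h2]
    simp only [← Complex.coe_smul, inner_smul_left, Complex.conj_ofReal, smul_smul]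
    congr 1
    push_cast
    ring
  rw [hconj, zero_add, smul_smul, ← Real.rpow_add_one hε.ne', add_comm]

theorem IsEigenbasis.eq_spectralOp {A : H →L[ℂ] H} {b : OrthonormalBasis ι ℂ H} {l : ι → ℝ}
    (h : IsEigenbasis A b l) : A = spectralOp b l :=
  h.unique (isEigenbasis_spectralOp b l)

/-- Bernoulli's inequality on eigenvalues; it transfers divergence of `Tr A` to `Tr A ^ p`. -/
theorem mul_opTrace_sub_le_opTrace_rpow {A : H →L[ℂ] H} (hA : 0 ≤ A) {p : ℝ} (hp : 1 ≤ p) :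
    p * opTrace A - (p - 1) * Module.finrank ℂ H ≤ opTrace (A ^ p) := by
  obtain ⟨b, l, h⟩ := exists_isEigenbasis hA.isSelfAdjoint
  rw [h.opTrace, (h.rpow hA p).opTrace]
  have : ∑ i, (p * l i - (p - 1)) ≤ ∑ i, l i ^ p := by
    refine Finset.sum_le_sum fun i _ => ?_
    have := one_add_mul_self_le_rpow_one_add (s := l i - 1) (by linarith [h.nonneg hA i]) hp
    rw [add_sub_cancel] at this
    linarith
  simp only [Finset.sum_sub_distrib, ← Finset.mul_sum, Finset.sum_const, Finset.card_univ,
    Fintype.card_fin, nsmul_eq_mul] at this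
  linarith

theorem exists_tendsto_renyiQReg_sandwiched {ρ σ : H →L[ℂ] H} (hρ : 0 ≤ ρ) (hσ : 0 ≤ σ) {a : ℝ}
    (ha : 0 < a) :
    ∃ L, Tendsto (renyiQReg .sandwiched a ρ σ) (𝓝[>] 0) (𝓝 L) := by
  obtain ⟨f, m, hf⟩ := exists_isEigenbasis hσ.isSelfAdjoint
  set s := (1 - a) / a with hs
  have hs1 : -1 < s := by
    rw [hs, lt_div_iff₀ ha]; linarith
  set Y : ℝ → H →L[ℂ] H := fun ε => (ρ + ε • (1 : H →L[ℂ] H)) ^ (1 / 2 : ℝ) *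
    (σ + ε • (1 : H →L[ℂ] H)) ^ s * (ρ + ε • (1 : H →L[ℂ] H)) ^ (1 / 2 : ℝ) with hY
  have hYnn : ∀ ε, 0 < ε → 0 ≤ Y ε := fun ε hε =>
    conjugate_nonneg_of_nonneg CFC.rpow_nonneg CFC.rpow_nonneg
  -- For `s < 0` the condition says that the kernel of `σ` lies in that of `ρ`. If it holds, the
  -- operators themselves converge; otherwise their trace diverges.
  by_cases hsupp : ∀ j, m j ≠ 0 ∨ 0 ≤ s ∨ quadForm ρ (f j) = 0
  · choose L hL using fun j => exists_tendsto_sandwiched_term hρ hs1 (hsupp j)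
    have hlim : Tendsto Y (𝓝[>] 0) (𝓝 (∑ j, L j)) := by
      refine (tendsto_finsetSum _ fun j _ => hL j).congr' ?_
      filter_upwards [self_mem_nhdsWithin] with ε (hε : 0 < ε)
      rw [hY]
      simp only
      rw [((hf.add_smul_one ε).rpow (isStrictlyPositive_add_smul_one hσ hε).nonneg s).eq_spectralOp,
        spectralOp, Finset.mul_sum, Finset.sum_mul]
      refine Finset.sum_congr rfl fun j _ => ?_
      rw [mul_smul_comm, smul_mul_assoc]
    have hev : ∀ᶠ ε in 𝓝[>] (0 : ℝ), 0 ≤ Y ε := by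
      filter_upwards [self_mem_nhdsWithin] with ε hε using hYnn ε hε
    have h0 : 0 ≤ ∑ j, L j := ge_of_tendsto hlim hev
    exact ⟨_, ENNReal.tendsto_ofReal ((continuous_opTrace.tendsto _).comp
      (((continuousOn_rpow_nonneg (H := H) ha.le) _ h0).tendsto.comp
        (tendsto_nhdsWithin_iff.2 ⟨hlim, hev⟩)))⟩
  · push Not at hsupp
    obtain ⟨j, hmj, hs0, hj⟩ := hsupp
    have ha1 : 1 ≤ a := by
      by_contra! h
      exact absurd hs0 (not_lt.2 (div_nonneg (by linarith) ha.le))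
    have hc : 0 < quadForm ρ (f j) := lt_of_le_of_ne (quadForm_nonneg hρ _) (Ne.symm hj)
    refine ⟨∞, ENNReal.tendsto_ofReal_atTop.comp ?_⟩
    have hlow : Tendsto (fun ε : ℝ => a * (ε ^ s * quadForm ρ (f j)) -
        (a - 1) * Module.finrank ℂ H) (𝓝[>] 0) atTop :=
      tendsto_atTop_add_const_right _ _ (Tendsto.const_mul_atTop ha
        ((tendsto_rpow_neg_nhdsGT_zero hs0).atTop_mul_const hc))
    refine tendsto_atTop_mono' _ ?_ hlow
    filter_upwards [self_mem_nhdsWithin] with ε (hε : 0 < ε)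
    have hρε := isStrictlyPositive_add_smul_one hρ hε
    have hσε := isStrictlyPositive_add_smul_one hσ hε
    refine le_trans ?_ (mul_opTrace_sub_le_opTrace_rpow (hYnn ε hε) ha1)
    -- By cyclicity the trace is that of `(σ + ε)^s (ρ + ε)`.
    have htr : opTrace (Y ε) = ∑ i, (m i + ε) ^ s * quadForm (ρ + ε • (1 : H →L[ℂ] H)) (f i) := by
      rw [← ((hf.add_smul_one ε).rpow hσε.nonneg s).opTrace_mul CFC.rpow_nonneg.isSelfAdjoint, hY]
      simp only
      rw [mul_assoc, opTrace_mul_comm, mul_assoc, ← CFC.rpow_add hρε.isUnit, add_halves,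
        CFC.rpow_one _ hρε.nonneg]
    have hterm : ε ^ s * quadForm ρ (f j) ≤ opTrace (Y ε) := by
      rw [htr]
      refine le_trans ?_ (Finset.single_le_sum (fun i _ => mul_nonneg (Real.rpow_nonneg
        (add_nonneg (hf.nonneg hσ i) hε.le) _) (quadForm_nonneg hρε.nonneg _)) (Finset.mem_univ j))
      rw [hmj, zero_add, quadForm_add, quadForm_smul, quadForm_one]
      have : 0 ≤ ε * ‖f j‖ ^ 2 := by positivity
      gcongr
      linarith
    gcongr

/-- Peierls for `B` in the eigenbasis of `A`: the trace of `exp` is monotone although `exp` is not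
operator monotone. -/
theorem opTrace_exp_le_mul {A B : H →L[ℂ] H} (hA : IsSelfAdjoint A) (hB : IsSelfAdjoint B) {δ : ℝ}
    (h : ∀ v, ‖v‖ = 1 → quadForm A v ≤ quadForm B v + δ) :
    opTrace (NormedSpace.exp A) ≤ Real.exp δ * opTrace (NormedSpace.exp B) := by
  obtain ⟨b, l, hb⟩ := exists_isEigenbasis hA
  rw [(hb.exp hA).opTrace]
  refine le_trans ?_ (mul_le_mul_of_nonneg_left (sum_exp_quadForm_le b hB) (Real.exp_pos δ).le)
  rw [Finset.mul_sum]
  refine Finset.sum_le_sum fun i _ => ?_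
  rw [← Real.exp_add, ← hb.quadForm i, Real.exp_le_exp, add_comm]
  exact h _ (b.norm_eq_one i)

theorem exp_quadForm_le_opTrace_exp {S : H →L[ℂ] H} (hS : IsSelfAdjoint S) {v : H} (hv : ‖v‖ = 1) :
    Real.exp (quadForm S v) ≤ opTrace (NormedSpace.exp S) := by
  obtain ⟨e, l, h⟩ := exists_isEigenbasis hS
  refine (h.map_quadForm_le convexOn_exp (fun _ => Set.mem_univ _) hv).trans ?_
  rw [(h.exp hS).opTrace]
  refine Finset.sum_le_sum fun i _ => mul_le_of_le_one_left (Real.exp_pos _).le ?_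
  have := norm_inner_le_norm (𝕜 := ℂ) (e i) v
  rw [hv, e.norm_eq_one, mul_one] at this
  exact pow_le_one₀ (norm_nonneg _) this

/-- If `T ≤ 0`, the trace with `K0` in place of `K y` decreases in the scalar, and replacing `K0` by
`K y` costs at most a factor `exp (±‖K y - K0‖)`. If `T` is positive on some unit vector, that
vector alone forces divergence. -/
theorem exists_tendsto_opTrace_exp_add_smul {l : Filter X} {K : X → H →L[ℂ] H} {K0 T : H →L[ℂ] H}
    {x : X → ℝ} (hK : ∀ y, IsSelfAdjoint (K y)) (hK0 : IsSelfAdjoint K0) (hT : IsSelfAdjoint T)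
    (hlim : Tendsto K l (𝓝 K0)) (hx : Tendsto x l atTop) :
    ∃ L, Tendsto (fun y => ENNReal.ofReal (opTrace (NormedSpace.exp (K y + x y • T)))) l (𝓝 L) := by
  have hxT : ∀ r : ℝ, IsSelfAdjoint (r • T) := fun r => (IsSelfAdjoint.all r).smul hT
  by_cases hneg : ∀ v, ‖v‖ = 1 → quadForm T v ≤ 0
  · set g : ℝ → ℝ := fun r => opTrace (NormedSpace.exp (K0 + r • T)) with hg
    have hanti : Antitone g := fun r r' hrr' => by
      have := opTrace_exp_le_mul (hK0.add (hxT r')) (hK0.add (hxT r)) (δ := 0) fun v hv => by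
        simp only [quadForm_add, quadForm_smul]
        nlinarith [hneg v hv]
      simpa using this
    have hgnn : ∀ r, 0 ≤ g r := fun r => by
      rw [hg]
      simp only
      rw [opTrace_eq_sum _ (stdOrthonormalBasis ℂ H)]
      exact Finset.sum_nonneg fun i _ => quadForm_nonneg (hK0.add (hxT r)).exp_nonneg _
    have hglim : Tendsto (fun y => g (x y)) l (𝓝 (⨅ r, g r)) :=
      (tendsto_atTop_ciInf hanti ⟨0, by rintro _ ⟨r, rfl⟩; exact hgnn r⟩).comp hx
    have hd : Tendsto (fun y => ‖K y - K0‖) l (𝓝 0) := tendsto_iff_norm_sub_tendsto_zero.1 hlim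
    have hq : ∀ y v, ‖v‖ = 1 → |quadForm (K y) v - quadForm K0 v| ≤ ‖K y - K0‖ := fun y v hv => by
      rw [← quadForm_sub]
      exact abs_quadForm_le _ hv
    have hlow : Tendsto (fun y => Real.exp (-‖K y - K0‖) * g (x y)) l (𝓝 (⨅ r, g r)) := by
      have := ((Real.continuous_exp.tendsto _).comp hd.neg).mul hglim
      simpa using this
    have hhigh : Tendsto (fun y => Real.exp ‖K y - K0‖ * g (x y)) l (𝓝 (⨅ r, g r)) := by
      have := ((Real.continuous_exp.tendsto _).comp hd).mul hglim
      simpa using this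
    refine ⟨_, ENNReal.tendsto_ofReal (tendsto_of_tendsto_of_tendsto_of_le_of_le hlow hhigh
      (fun y => ?_) fun y => ?_)⟩
    · have := opTrace_exp_le_mul (hK0.add (hxT (x y))) ((hK y).add (hxT (x y)))
        (δ := ‖K y - K0‖) fun v hv => by
          rw [quadForm_add, quadForm_add]
          linarith [(abs_le.1 (hq y v hv)).1]
      simp only
      rw [Real.exp_neg, inv_mul_le_iff₀ (Real.exp_pos _)]
      exact this
    · exact opTrace_exp_le_mul ((hK y).add (hxT (x y))) (hK0.add (hxT (x y)))
        (δ := ‖K y - K0‖) fun v hv => by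
          rw [quadForm_add, quadForm_add]
          linarith [(abs_le.1 (hq y v hv)).2]
  · push Not at hneg
    obtain ⟨v, hv, hTv⟩ := hneg
    refine ⟨∞, ENNReal.tendsto_ofReal_atTop.comp (tendsto_atTop_mono
      (fun y => exp_quadForm_le_opTrace_exp ((hK y).add (hxT (x y))) hv) ?_)⟩
    refine Real.tendsto_exp_atTop.comp ?_
    simp only [quadForm_add, quadForm_smul]
    exact (((continuous_quadForm v).tendsto K0).comp hlim).add_atTop (hx.atTop_mul_const hTv)

/-- Separates the convergent part of the logarithm from its divergence, which is `log ε` times the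
kernel projection. The minus signs make the scalar factor tend to `+∞`. -/
theorem log_add_smul_one_eq {A : H →L[ℂ] H} (hA : 0 ≤ A) {b : OrthonormalBasis ι ℂ H} {l : ι → ℝ}
    (hb : IsEigenbasis A b l) {ε : ℝ} (hε : 0 < ε) :
    CFC.log (A + ε • (1 : H →L[ℂ] H)) = spectralOp b (fun i => if l i = 0 then 0 else Real.log (l i + ε))
      + (-Real.log ε) • spectralOp b (fun i => if l i = 0 then -1 else 0) := by
  refine (hb.add_smul_one ε).log (isStrictlyPositive_add_smul_one hA hε).isSelfAdjoint |>.congr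
    (fun i => ?_) |>.unique
    ((isEigenbasis_spectralOp b _).add ((isEigenbasis_spectralOp b _).smul _))
  by_cases h : l i = 0 <;> simp [h]

theorem exists_tendsto_renyiQReg_logEuclidean {ρ σ : H →L[ℂ] H} (hρ : 0 ≤ ρ) (hσ : 0 ≤ σ) (a : ℝ) :
    ∃ L, Tendsto (renyiQReg .logEuclidean a ρ σ) (𝓝[>] 0) (𝓝 L) := by
  obtain ⟨b, l, hb⟩ := exists_isEigenbasis hρ.isSelfAdjoint
  obtain ⟨f, m, hf⟩ := exists_isEigenbasis hσ.isSelfAdjoint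
  have hcomb : ∀ g h : Fin (Module.finrank ℂ H) → ℝ,
      IsSelfAdjoint (a • spectralOp b g + (1 - a) • spectralOp f h) := fun g h =>
    ((IsSelfAdjoint.all a).smul (isSelfAdjoint_spectralOp b g)).add
      ((IsSelfAdjoint.all (1 - a)).smul (isSelfAdjoint_spectralOp f h))
  have hlim : ∀ (e : OrthonormalBasis (Fin (Module.finrank ℂ H)) ℂ H)
      (n : Fin (Module.finrank ℂ H) → ℝ), Tendsto (fun ε : ℝ =>
      spectralOp e (fun i => if n i = 0 then 0 else Real.log (n i + ε))) (𝓝[>] 0)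
      (𝓝 (spectralOp e (fun i => if n i = 0 then 0 else Real.log (n i)))) := fun e n => by
    refine tendsto_spectralOp e fun i => ?_
    by_cases h : n i = 0
    · simp [h]
    · simp only [h, if_false]
      exact (tendsto_const_add_nhdsGT_zero (n i)).log h
  obtain ⟨L, hL⟩ := exists_tendsto_opTrace_exp_add_smul (fun ε => hcomb _ _) (hcomb _ _)
    (hcomb (fun i => if l i = 0 then -1 else 0) (fun i => if m i = 0 then -1 else 0))
    (((hlim b l).const_smul a).add ((hlim f m).const_smul (1 - a)))
    (tendsto_neg_atBot_atTop.comp Real.tendsto_log_nhdsGT_zero)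
  refine ⟨L, hL.congr' ?_⟩
  filter_upwards [self_mem_nhdsWithin] with ε (hε : 0 < ε)
  rw [renyiQReg, renyiQPosDef, log_add_smul_one_eq hρ hb hε, log_add_smul_one_eq hσ hf hε]
  congr 3
  simp only [Function.comp, smul_add, smul_comm a, smul_comm (1 - a)]
  abel

theorem exists_tendsto_renyiQReg {ρ σ : H →L[ℂ] H} (hρ : 0 ≤ ρ) (hσ : 0 ≤ σ) (t : RenyiFamily)
    {a : ℝ} (ha : 0 < a) :
    ∃ L, Tendsto (renyiQReg t a ρ σ) (𝓝[>] 0) (𝓝 L) := by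
  cases t with
  | petz => exact exists_tendsto_renyiQReg_petz hρ hσ ha
  | sandwiched => exact exists_tendsto_renyiQReg_sandwiched hρ hσ ha
  | logEuclidean => exact exists_tendsto_renyiQReg_logEuclidean hρ hσ a

end Regularisation

/-! ### Divergences of semidefinite operators and the endpoints `0` and `∞`. -/

section Divergences

variable {H : Type*} [NormedAddCommGroup H] [InnerProductSpace ℂ H]
variable [FiniteDimensional ℂ H] [CompleteSpace H]

theorem tendsto_renyiQReg {ρ σ : H →L[ℂ] H} (hρ : 0 ≤ ρ) (hσ : 0 ≤ σ) (t : RenyiFamily)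
    {a : ℝ} (ha : 0 < a) :
    Tendsto (renyiQReg t a ρ σ) (𝓝[>] 0) (𝓝 (renyiQ t a ρ σ)) :=
  tendsto_nhds_limUnder (exists_tendsto_renyiQReg hρ hσ t ha)

theorem opTrace_pos_of_ne_zero {A : H →L[ℂ] H} (hA : 0 ≤ A) (hA0 : A ≠ 0) : 0 < opTrace A := by
  obtain ⟨b, l, h⟩ := exists_isEigenbasis hA.isSelfAdjoint
  rw [h.opTrace]
  refine lt_of_le_of_ne (Finset.sum_nonneg fun i _ => h.nonneg hA i) fun h0 => hA0 ?_
  rw [eq_comm, Finset.sum_eq_zero_iff_of_nonneg fun i _ => h.nonneg hA i] at h0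
  refine h.unique fun i => ?_
  simp [h0 i (Finset.mem_univ i)]

/-- Using `Tr (ρ + ε)` instead of `Tr ρ` does not change the limit, and it makes the approximants
genuine secant slopes, so that monotonicity in `α` survives `ε ↘ 0`. -/
theorem tendsto_secant_log_renyiQPosDef {ρ σ : H →L[ℂ] H} (hρ : 0 ≤ ρ) (hρ0 : ρ ≠ 0) (hσ : 0 ≤ σ)
    (t : RenyiFamily) {a : ℝ} (ha : 0 < a) :
    Tendsto (fun ε : ℝ => (((Real.log (renyiQPosDef t a (ρ + ε • (1 : H →L[ℂ] H))
        (σ + ε • (1 : H →L[ℂ] H))) - Real.log (opTrace (ρ + ε • (1 : H →L[ℂ] H)))) / (a - 1) : ℝ) :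
          EReal)) (𝓝[>] 0) (𝓝 (renyiDivReal t a ρ σ)) := by
  have : Nontrivial H := by
    by_contra h
    rw [not_nontrivial_iff_subsingleton] at h
    exact hρ0 (Subsingleton.elim _ _)
  have h1 : Tendsto (fun ε => ((1 / (a - 1) : ℝ) : EReal) * ENNReal.log (renyiQReg t a ρ σ ε))
      (𝓝[>] 0) (𝓝 (((1 / (a - 1) : ℝ) : EReal) * ENNReal.log (renyiQ t a ρ σ))) :=
    EReal.Tendsto.const_mul
      ((ENNReal.continuous_log.tendsto _).comp (tendsto_renyiQReg hρ hσ t ha))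
      (Or.inl (EReal.coe_ne_bot _)) (Or.inl (EReal.coe_ne_top _))
  have h2 : Tendsto (fun ε : ℝ => 1 / (a - 1) * Real.log (opTrace (ρ + ε • (1 : H →L[ℂ] H))))
      (𝓝[>] 0) (𝓝 (1 / (a - 1) * Real.log (opTrace ρ))) := by
    have hcont : Continuous fun ε : ℝ => opTrace (ρ + ε • (1 : H →L[ℂ] H)) :=
      continuous_opTrace.comp (by fun_prop)
    have h3 := hcont.tendsto 0
    rw [zero_smul, add_zero] at h3
    exact ((h3.mono_left nhdsWithin_le_nhds).log (opTrace_pos_of_ne_zero hρ hρ0).ne').const_mul _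
  have h2' := (continuous_coe_real_ereal.tendsto _).comp h2.neg
  have h3 : Tendsto (fun ε => ((1 / (a - 1) : ℝ) : EReal) * ENNReal.log (renyiQReg t a ρ σ ε)
      - ((1 / (a - 1) * Real.log (opTrace (ρ + ε • (1 : H →L[ℂ] H))) : ℝ) : EReal)) (𝓝[>] 0)
      (𝓝 (renyiDivReal t a ρ σ)) := by
    -- The trace term has a finite limit, so addition in `EReal` is continuous at the limit point.
    simp only [sub_eq_add_neg (G := EReal), renyiDivReal, ← EReal.coe_neg]
    exact (EReal.continuousAt_add (Or.inr (EReal.coe_ne_bot _))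
      (Or.inr (EReal.coe_ne_top _))).tendsto.comp (h1.prodMk_nhds h2')
  refine h3.congr' ?_
  filter_upwards [self_mem_nhdsWithin] with ε (hε : 0 < ε)
  have hQ := renyiQPosDef_pos (isStrictlyPositive_add_smul_one hρ hε)
    (isStrictlyPositive_add_smul_one hσ hε) t a
  rw [renyiQReg, ENNReal.log_ofReal_of_pos hQ, ← EReal.coe_mul, ← EReal.coe_sub]
  congr 1
  ring

theorem renyiDivReal_mono {ρ σ : H →L[ℂ] H} (hρ : 0 ≤ ρ) (hρ0 : ρ ≠ 0) (hσ : 0 ≤ σ)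
    (t : RenyiFamily) {a b : ℝ} (ha : 0 < a) (ha1 : a ≠ 1) (hb1 : b ≠ 1) (hab : a ≤ b) :
    renyiDivReal t a ρ σ ≤ renyiDivReal t b ρ σ := by
  have : Nontrivial H := by
    by_contra h
    rw [not_nontrivial_iff_subsingleton] at h
    exact hρ0 (Subsingleton.elim _ _)
  refine le_of_tendsto_of_tendsto (tendsto_secant_log_renyiQPosDef hρ hρ0 hσ t ha)
    (tendsto_secant_log_renyiQPosDef hρ hρ0 hσ t (ha.trans_le hab)) ?_
  filter_upwards [self_mem_nhdsWithin] with ε (hε : 0 < ε)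
  exact EReal.coe_le_coe_iff.2 (secant_log_renyiQPosDef_mono
    (isStrictlyPositive_add_smul_one hρ hε) (isStrictlyPositive_add_smul_one hσ hε) t ha ha1 hb1 hab)

theorem tendsto_renyiDivReal_zero {ρ σ : H →L[ℂ] H} (hρ : 0 ≤ ρ) (hρ0 : ρ ≠ 0) (hσ : 0 ≤ σ)
    (t : RenyiFamily) :
    Tendsto (fun a : ℝ => renyiDivReal t a ρ σ) (𝓝[>] 0) (𝓝 (renyiDiv t 0 ρ σ)) := by
  rw [renyiDiv, if_pos rfl]
  refine tendsto_nhds_limUnder ⟨_, MonotoneOn.tendsto_nhdsWithin_Ioo_right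
    (y := 1) (by simp) (fun a ha b hb hab => ?_) (OrderBot.bddBelow _)⟩
  exact renyiDivReal_mono hρ hρ0 hσ t ha.1 ha.2.ne hb.2.ne hab

theorem tendsto_renyiDivReal_atTop {ρ σ : H →L[ℂ] H} (hρ : 0 ≤ ρ) (hρ0 : ρ ≠ 0) (hσ : 0 ≤ σ)
    (t : RenyiFamily) :
    Tendsto (fun a : ℝ => renyiDivReal t a ρ σ) atTop (𝓝 (renyiDiv t ⊤ ρ σ)) := by
  rw [renyiDiv, if_neg ENNReal.top_ne_zero, if_neg ENNReal.top_ne_one, if_pos rfl]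
  -- Cutting off at `2` keeps the parameter positive and away from `1`.
  have hmono : Monotone fun a : ℝ => renyiDivReal t (max a 2) ρ σ := fun a b hab => by
    have h1 : (2 : ℝ) ≤ max a 2 := le_max_right _ _
    have h2 : (2 : ℝ) ≤ max b 2 := le_max_right _ _
    exact renyiDivReal_mono hρ hρ0 hσ t (by linarith) (by linarith) (by linarith)
      (max_le_max_right 2 hab)
  refine tendsto_nhds_limUnder ⟨_, (tendsto_atTop_iSup hmono).congr' ?_⟩
  filter_upwards [eventually_ge_atTop 2] with a ha
  rw [max_eq_left ha]

theorem renyiDivReal_le_of_lt_one {ρ σ : H →L[ℂ] H} (hρ : 0 ≤ ρ) (hσ : 0 ≤ σ) {s t : RenyiFamily}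
    {a : ℝ} (ha : 0 < a) (ha1 : a < 1)
    (h : ∀ {ρ σ : H →L[ℂ] H}, IsStrictlyPositive ρ → IsStrictlyPositive σ →
      renyiQPosDef t a ρ σ ≤ renyiQPosDef s a ρ σ) :
    renyiDivReal s a ρ σ ≤ renyiDivReal t a ρ σ := by
  have hQ : renyiQ t a ρ σ ≤ renyiQ s a ρ σ := by
    refine le_of_tendsto_of_tendsto (tendsto_renyiQReg hρ hσ t ha)
      (tendsto_renyiQReg hρ hσ s ha) ?_
    filter_upwards [self_mem_nhdsWithin] with ε (hε : 0 < ε)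
    exact ENNReal.ofReal_le_ofReal (h (isStrictlyPositive_add_smul_one hρ hε)
      (isStrictlyPositive_add_smul_one hσ hε))
  -- The prefactor is negative for `a < 1`: multiply by its nonnegative opposite, then negate.
  have hc : 0 ≤ ((-(1 / (a - 1)) : ℝ) : EReal) :=
    EReal.coe_nonneg.2 (neg_nonneg.2 (one_div_nonpos.2 (by linarith)))
  have h1 := EReal.neg_le_neg_iff.2 (mul_le_mul_of_nonneg_left (ENNReal.log_le_log hQ) hc)
  rw [EReal.coe_neg, EReal.neg_mul, EReal.neg_mul, neg_neg, neg_neg] at h1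
  exact EReal.sub_le_sub h1 le_rfl

theorem renyiDivReal_le_of_one_lt {ρ σ : H →L[ℂ] H} (hρ : 0 ≤ ρ) (hσ : 0 ≤ σ) {s t : RenyiFamily}
    {a : ℝ} (ha1 : 1 < a)
    (h : ∀ {ρ σ : H →L[ℂ] H}, IsStrictlyPositive ρ → IsStrictlyPositive σ →
      renyiQPosDef s a ρ σ ≤ renyiQPosDef t a ρ σ) :
    renyiDivReal s a ρ σ ≤ renyiDivReal t a ρ σ := by
  have ha : 0 < a := by linarith
  have hQ : renyiQ s a ρ σ ≤ renyiQ t a ρ σ := by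
    refine le_of_tendsto_of_tendsto (tendsto_renyiQReg hρ hσ s ha)
      (tendsto_renyiQReg hρ hσ t ha) ?_
    filter_upwards [self_mem_nhdsWithin] with ε (hε : 0 < ε)
    exact ENNReal.ofReal_le_ofReal (h (isStrictlyPositive_add_smul_one hρ hε)
      (isStrictlyPositive_add_smul_one hσ hε))
  have hc : 0 ≤ ((1 / (a - 1) : ℝ) : EReal) :=
    EReal.coe_nonneg.2 (one_div_nonneg.2 (by linarith))
  exact EReal.sub_le_sub (mul_le_mul_of_nonneg_left (ENNReal.log_le_log hQ) hc) le_rfl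

theorem renyiDiv_le_of_lt_one {ρ σ : H →L[ℂ] H} (hρ : 0 ≤ ρ) (hρ0 : ρ ≠ 0) (hσ : 0 ≤ σ)
    {s t : RenyiFamily}
    (h : ∀ a : ℝ, 0 < a → a < 1 → renyiDivReal s a ρ σ ≤ renyiDivReal t a ρ σ)
    {α : ℝ≥0∞} (hα : α < 1) : renyiDiv s α ρ σ ≤ renyiDiv t α ρ σ := by
  rcases eq_or_ne α 0 with rfl | h0
  · refine le_of_tendsto_of_tendsto (tendsto_renyiDivReal_zero hρ hρ0 hσ s)
      (tendsto_renyiDivReal_zero hρ hρ0 hσ t) ?_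
    filter_upwards [Ioo_mem_nhdsGT (zero_lt_one' ℝ)] with a ha using h a ha.1 ha.2
  · have htop : α ≠ ⊤ := (hα.trans ENNReal.one_lt_top).ne
    simp only [renyiDiv, if_neg h0, if_neg hα.ne, if_neg htop]
    exact h _ (ENNReal.toReal_pos h0 htop) (by simpa using (ENNReal.toReal_lt_toReal htop ENNReal.one_ne_top).2 hα)

theorem renyiDiv_le_of_one_lt {ρ σ : H →L[ℂ] H} (hρ : 0 ≤ ρ) (hρ0 : ρ ≠ 0) (hσ : 0 ≤ σ)
    {s t : RenyiFamily}
    (h : ∀ a : ℝ, 1 < a → renyiDivReal s a ρ σ ≤ renyiDivReal t a ρ σ)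
    {α : ℝ≥0∞} (hα : 1 < α) : renyiDiv s α ρ σ ≤ renyiDiv t α ρ σ := by
  rcases eq_or_ne α ⊤ with rfl | htop
  · refine le_of_tendsto_of_tendsto (tendsto_renyiDivReal_atTop hρ hρ0 hσ s)
      (tendsto_renyiDivReal_atTop hρ hρ0 hσ t) ?_
    filter_upwards [eventually_gt_atTop 1] with a ha using h a ha
  · have h0 : α ≠ 0 := (zero_lt_one.trans hα).ne'
    simp only [renyiDiv, if_neg h0, if_neg hα.ne', if_neg htop]
    exact h _ (by simpa using (ENNReal.toReal_lt_toReal ENNReal.one_ne_top htop).2 hα)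

end Divergences

/-- Ordering of the three families of quantum Rényi divergences. The first three conjuncts say that
the limits by which the divergences are defined exist. -/
theorem mainTheorem11 {H : Type*} [NormedAddCommGroup H] [InnerProductSpace ℂ H]
    [FiniteDimensional ℂ H] [CompleteSpace H] (ρ σ : H →L[ℂ] H)
    (hρ : ρ.IsPositive) (hρ0 : ρ ≠ 0) (hσ : σ.IsPositive) (hσ0 : σ ≠ 0) :
    (∀ (t : RenyiFamily) (a : ℝ), 0 < a → a ≠ 1 →
      Tendsto (renyiQReg t a ρ σ) (𝓝[>] (0 : ℝ)) (𝓝 (renyiQ t a ρ σ))) ∧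
    (∀ t : RenyiFamily,
      Tendsto (fun a : ℝ => renyiDivReal t a ρ σ) (𝓝[>] (0 : ℝ)) (𝓝 (renyiDiv t 0 ρ σ))) ∧
    (∀ t : RenyiFamily,
      Tendsto (fun a : ℝ => renyiDivReal t a ρ σ) atTop (𝓝 (renyiDiv t ⊤ ρ σ))) ∧
    (∀ α : ℝ≥0∞, α < 1 →
      renyiDiv .sandwiched α ρ σ ≤ renyiDiv .petz α ρ σ ∧
      renyiDiv .petz α ρ σ ≤ renyiDiv .logEuclidean α ρ σ) ∧
    (∀ α : ℝ≥0∞, 1 < α →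
      renyiDiv .logEuclidean α ρ σ ≤ renyiDiv .sandwiched α ρ σ ∧
      renyiDiv .sandwiched α ρ σ ≤ renyiDiv .petz α ρ σ) := by
  have hρ' := (ContinuousLinearMap.nonneg_iff_isPositive ρ).2 hρ
  have hσ' := (ContinuousLinearMap.nonneg_iff_isPositive σ).2 hσ
  refine ⟨fun t a ha _ => tendsto_renyiQReg hρ' hσ' t ha,
    tendsto_renyiDivReal_zero hρ' hρ0 hσ', tendsto_renyiDivReal_atTop hρ' hρ0 hσ',
    fun α hα => ⟨?_, ?_⟩, fun α hα => ⟨?_, ?_⟩⟩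
  · exact renyiDiv_le_of_lt_one hρ' hρ0 hσ' (fun a h0 h1 => renyiDivReal_le_of_lt_one hρ' hσ' h0 h1
      fun h h' => renyiQPosDef_petz_le_sandwiched h h' h0 h1) hα
  · exact renyiDiv_le_of_lt_one hρ' hρ0 hσ' (fun a h0 h1 => renyiDivReal_le_of_lt_one hρ' hσ' h0 h1
      fun h h' => renyiQPosDef_logEuclidean_le_petz h h' a) hα
  · exact renyiDiv_le_of_one_lt hρ' hρ0 hσ' (fun a h1 => renyiDivReal_le_of_one_lt hρ' hσ' h1
      fun h h' => renyiQPosDef_logEuclidean_le_sandwiched h h' (by linarith)) hα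
  · exact renyiDiv_le_of_one_lt hρ' hρ0 hσ' (fun a h1 => renyiDivReal_le_of_one_lt hρ' hσ' h1
      fun h h' => renyiQPosDef_sandwiched_le_petz h h' h1) hα
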